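/- Let $\mathbb{T}^d=\mathbb{R}^d/\mathbb{Z}^d$. For every integer $d\ge 4$ there are linear Anosov (hyperbolic) automorphisms $A\in GL(2,\mathbb{Z})$ of $\mathbb{T}^2$ and $B\in GL(d-2,\mathbb{Z})$ of $\mathbb{T}^{d-2}$, each with distinct real eigenvalues, integers $1\le n<m$, and an eigenvector $e_u\in\mathbb{R}^{d-2}\setminus\{0\}$ of $B$ with $Be_u=\lambda e_u$, $|\lambda|>1$, such that the linear automorphism $L(x,y)=(A^nx,B^my)$ of $\mathbb{T}^d=\mathbb{T}^2\times\mathbb{T}^{d-2}$ is Anosov with $d$ distinct real eigenvalues and the following holds. Every neighborhood of $L$ in the $C^\infty$ topology contains a $C^\infty$ diffeomorphism $f:\mathbb{T}^d\to\mathbb{T}^d$ of the form $$f(x,y)=(A^nx,\;B^my+\psi(x)e_u),\qquad \psi\in C^\infty(\mathbb{T}^2,\mathbb{R}),$$ such that 1. $f$ is an Anosov diffeomorphism; 2. every point $p\in\mathbb{T}^d$ is Lyapunov regular for $f$, i.e. all Lyapunov exponents are defined at $p$: there are numbers $\chi_1<\dots<\chi_k$ and a splitting $T_p\mathbb{T}^d=E_1\oplus\dots\oplus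 E_k$ into nonzero subspaces such that $\lim_{j\to\pm\infty}\frac1j\log\|Df^j(p)v\|=\chi_i$ for all $v\in E_i\setminus\{0\}$, and $\lim_{j\to\pm\infty}\frac1j\log|\det Df^j(p)|=\sum_i\chi_i\dim E_i$; 3. the linearization of $f$ (the automorphism of $\mathbb{T}^d$ given by $f_*$ on $\pi_1(\mathbb{T}^d)=\mathbb{Z}^d$) is $L$, and there is a homeomorphism $h$ of $\mathbb{T}^d$ with $h\circ f=L\circ h$; 4. $f$ is not Lipschitz conjugate to $L$, nor to any other linear automorphism: if $N\in GL(d,\mathbb{Z})$ and $h$ is a homeomorphism of $\mathbb{T}^d$ with $h\circ f=N\circ h$, then neither $h$ nor $h^{-1}$ is Lipschitz. -/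

import Mathlib

open Filter Topology
open scoped ContDiff NNReal

noncomputable section

/-- The torus `𝕋^d = (ℝ/ℤ)^d`, a compact abelian group. Mathlib's distance on it is the maximum of
the circle distances of the coordinates, which is Lipschitz equivalent to the flat Riemannian one. -/
abbrev Torus (d : ℕ) : Type := Fin d → UnitAddCircle

/-- The universal covering `ℝ^d → 𝕋^d`. -/
def Torus.proj {d : ℕ} (x : Fin d → ℝ) : Torus d := fun i => (x i : UnitAddCircle)

theorem Torus.proj_surjective (d : ℕ) : Function.Surjective (Torus.proj (d := d)) := by
  intro p
  choose x hx using fun i => QuotientAddGroup.mk_surjective (p i)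
  exact ⟨x, funext hx⟩

/-- The action of an integer matrix on column vectors with entries in an abelian group `V`,
`(M v)_i = ∑_j M_{ij} v_j`. It is used for `V = ℤ, ℝ, ℂ` and `V = ℝ/ℤ`. -/
def intAct {d : ℕ} {V : Type*} [AddCommGroup V] (M : Matrix (Fin d) (Fin d) ℤ) (v : Fin d → V) :
    Fin d → V :=
  fun i => ∑ j, M i j • v j

theorem intAct_one {d : ℕ} {V : Type*} [AddCommGroup V] (v : Fin d → V) : intAct 1 v = v := by
  funext i
  simp [intAct, Matrix.one_apply, ite_smul]

theorem intAct_mul {d : ℕ} {V : Type*} [AddCommGroup V] (M N : Matrix (Fin d) (Fin d) ℤ)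
    (v : Fin d → V) : intAct (M * N) v = intAct M (intAct N v) := by
  funext i
  simp only [intAct, Matrix.mul_apply, Finset.sum_smul, Finset.smul_sum, mul_smul]
  exact Finset.sum_comm

/-- The bijection of `V^d` given by a matrix in `GL(d, ℤ)`. -/
def intActEquiv {d : ℕ} (V : Type*) [AddCommGroup V] (M : GL (Fin d) ℤ) :
    Equiv.Perm (Fin d → V) where
  toFun := intAct M.val
  invFun := intAct M.inv
  left_inv v := by rw [← intAct_mul, M.inv_val, intAct_one]
  right_inv v := by rw [← intAct_mul, M.val_inv, intAct_one]

/-- A `C^∞` diffeomorphism of the torus: a homeomorphism together with a lift to `ℝ^d` that is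
`C^∞` with `C^∞` inverse. (Every diffeomorphism has such lifts, any two differ by a constant vector
of `ℤ^d`, and no notion below depends on the lift.) -/
structure TorusDiffeo (d : ℕ) where
  toHomeomorph : Torus d ≃ₜ Torus d
  lift : Equiv.Perm (Fin d → ℝ)
  contDiff_lift : ContDiff ℝ ∞ lift
  contDiff_lift_symm : ContDiff ℝ ∞ lift.symm
  proj_lift : ∀ x, Torus.proj (lift x) = toHomeomorph (Torus.proj x)

theorem continuous_intAct {d : ℕ} {V : Type*} [AddCommGroup V] [TopologicalSpace V]
    [IsTopologicalAddGroup V] (M : Matrix (Fin d) (Fin d) ℤ) :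
    Continuous (intAct (V := V) M) := by
  unfold intAct
  fun_prop

theorem contDiff_intAct {d : ℕ} (M : Matrix (Fin d) (Fin d) ℤ) :
    ContDiff ℝ ∞ (intAct (V := ℝ) M) := by
  unfold intAct
  simp only [zsmul_eq_mul]
  fun_prop

theorem proj_intAct {d : ℕ} (M : Matrix (Fin d) (Fin d) ℤ) (x : Fin d → ℝ) :
    Torus.proj (intAct M x) = intAct M (Torus.proj x) := by
  funext i
  simp only [Torus.proj, intAct]
  rw [← QuotientAddGroup.mk'_apply, map_sum]
  simp only [map_zsmul, QuotientAddGroup.mk'_apply]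

namespace TorusDiffeo

variable {d : ℕ}

/-- The linear automorphism of the torus given by a matrix in `GL(d, ℤ)`. -/
def linear (M : GL (Fin d) ℤ) : TorusDiffeo d where
  toHomeomorph :=
    { intActEquiv UnitAddCircle M with
      continuous_toFun := continuous_intAct M.val
      continuous_invFun := continuous_intAct M.inv }
  lift := intActEquiv ℝ M
  contDiff_lift := contDiff_intAct M.val
  contDiff_lift_symm := contDiff_intAct M.inv
  proj_lift x := proj_intAct M.val x

/-- The derivative `Df^n(p)`, `n ∈ ℤ`, in the trivialization `T𝕋^d = 𝕋^d × ℝ^d`: the derivative of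
the `n`-th iterate of the lift at a point over `p` (any point over `p` gives the same,
`tangentMap_proj`). -/
def tangentMap (f : TorusDiffeo d) (n : ℤ) (p : Torus d) : (Fin d → ℝ) →L[ℝ] (Fin d → ℝ) :=
  fderiv ℝ (f.lift ^ n : Equiv.Perm (Fin d → ℝ))
    (Function.surjInv (Torus.proj_surjective d) p)

theorem contDiff_lift_zpow (f : TorusDiffeo d) (n : ℤ) :
    ContDiff ℝ ∞ (f.lift ^ n : Equiv.Perm (Fin d → ℝ)) := by
  induction n using Int.induction_on with
  | zero => simpa using contDiff_id
  | succ k ih =>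
    rw [zpow_add_one, Equiv.Perm.coe_mul]
    exact ih.comp f.contDiff_lift
  | pred k ih =>
    rw [zpow_sub_one, Equiv.Perm.coe_mul]
    exact ih.comp f.contDiff_lift_symm

theorem proj_lift_symm (f : TorusDiffeo d) (x : Fin d → ℝ) :
    Torus.proj (f.lift⁻¹ x) = f.toHomeomorph.symm (Torus.proj x) := by
  rw [f.toHomeomorph.eq_symm_apply, ← f.proj_lift]
  simp

theorem proj_lift_zpow (f : TorusDiffeo d) (n : ℤ) (x y : Fin d → ℝ)
    (h : Torus.proj x = Torus.proj y) :
    Torus.proj ((f.lift ^ n) x) = Torus.proj ((f.lift ^ n) y) := by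
  induction n using Int.induction_on generalizing x y with
  | zero => simpa using h
  | succ k ih =>
    rw [zpow_add_one, Equiv.Perm.mul_apply, Equiv.Perm.mul_apply]
    exact ih _ _ (by rw [f.proj_lift, f.proj_lift, h])
  | pred k ih =>
    rw [zpow_sub_one, Equiv.Perm.mul_apply, Equiv.Perm.mul_apply]
    exact ih _ _ (by rw [f.proj_lift_symm, f.proj_lift_symm, h])

theorem tangentMap_proj (f : TorusDiffeo d) (n : ℤ) (x : Fin d → ℝ) :
    f.tangentMap n (Torus.proj x) = fderiv ℝ (f.lift ^ n : Equiv.Perm (Fin d → ℝ)) x := by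
  unfold tangentMap
  set y := Function.surjInv (Torus.proj_surjective d) (Torus.proj x) with hy
  have hyx : Torus.proj y = Torus.proj x := Function.surjInv_eq _ _
  set F : (Fin d → ℝ) → (Fin d → ℝ) := ⇑(f.lift ^ n) with hF
  have hFc : Continuous F := (f.contDiff_lift_zpow n).continuous
  set c := y - x with hc
  have hproj : ∀ z, Torus.proj (z + c) = Torus.proj z := by
    intro z
    funext i
    have := congrFun hyx i
    simp only [Torus.proj] at this ⊢
    simp [hc, this]
  have hint : ∀ z i, ∃ k : ℤ, (F (z + c) - F z) i = k := by
    intro z i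
    have h1 := congrFun (f.proj_lift_zpow n _ _ (hproj z)) i
    simp only [Torus.proj] at h1
    have h2 : (((F (z + c) - F z) i : ℝ) : UnitAddCircle) = 0 := by
      rw [Pi.sub_apply, AddCircle.coe_sub, sub_eq_zero]
      exact h1
    obtain ⟨k, hk⟩ := (AddCircle.coe_eq_zero_iff (1 : ℝ)).1 h2
    exact ⟨k, by simpa using hk.symm⟩
  have hconst : ∀ z, F (z + c) - F z = F (x + c) - F x := by
    intro z
    funext i
    choose k hk using fun w => hint w i
    have hkc : Continuous k := by
      rw [Int.isClosedEmbedding_coe_real.isEmbedding.continuous_iff]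
      have : ((fun m : ℤ => (m : ℝ)) ∘ k) = fun w => (F (w + c) - F w) i :=
        funext fun w => (hk w).symm
      rw [this]
      fun_prop
    rw [hk, hk, PreconnectedSpace.constant inferInstance hkc]
  have hFe : (fun z => F (z + c)) = fun z => F z + (F (x + c) - F x) := by
    funext z
    rw [← hconst z]
    abel
  have h3 : fderiv ℝ (fun z => F (z + c)) x = fderiv ℝ F (x + c) := fderiv_comp_add_right c
  have hxy : y = x + c := by rw [hc]; abel
  rw [hxy, ← h3, hFe, fderiv_add_const]

/-- `M ∈ GL(d, ℤ)` is the linearization of `f`, the matrix of `f_*` on `π₁(𝕋^d) = ℤ^d`: the lift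
satisfies `F(x + k) = F(x) + M k` for `k ∈ ℤ^d`. -/
def IsLinearization (f : TorusDiffeo d) (M : GL (Fin d) ℤ) : Prop :=
  ∀ (x : Fin d → ℝ) (k : Fin d → ℤ),
    f.lift (x + fun i => (k i : ℝ)) = f.lift x + fun i => ((intAct M.val k i : ℤ) : ℝ)

/-- `f` is within `ε` of `g` in the `C^r` distance. The integer vector `c` makes this independent
of the lifts. -/
def CrClose (r : ℕ) (ε : ℝ) (f g : TorusDiffeo d) : Prop :=
  ∃ c : Fin d → ℤ, ∀ k ≤ r, ∀ x : Fin d → ℝ,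
    ‖iteratedFDeriv ℝ k (fun z => f.lift z - g.lift z - fun i => (c i : ℝ)) x‖ < ε

/-- `U` is a neighbourhood of `g` in the `C^∞` topology, the one generated by all the
`C^r` distances, `r ∈ ℕ`. -/
def IsCInftyNhd (U : Set (TorusDiffeo d)) (g : TorusDiffeo d) : Prop :=
  ∃ r : ℕ, ∃ ε : ℝ, 0 < ε ∧ {f | CrClose r ε f g} ⊆ U

/-- Anosov diffeomorphism: there is a `Df`-invariant splitting `Eu ⊕ Es` of the tangent bundle,
uniformly expanded resp. contracted. The splitting is continuous in the sense that the projection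
`P p` onto `Eu p` along `Es p` depends continuously on `p`. (The choice of the norm on `ℝ^d`
only affects the constant `C`.) -/
def IsAnosov (f : TorusDiffeo d) : Prop :=
  ∃ (Eu Es : Torus d → Submodule ℝ (Fin d → ℝ))
    (P : Torus d → ((Fin d → ℝ) →L[ℝ] (Fin d → ℝ))) (β η C : ℝ),
    (∀ p, IsCompl (Eu p) (Es p)) ∧
    Continuous P ∧
    (∀ p, ∀ v ∈ Eu p, P p v = v) ∧
    (∀ p, ∀ v ∈ Es p, P p v = 0) ∧
    (∀ p, (Eu p).map (f.tangentMap 1 p).toLinearMap = Eu (f.toHomeomorph p)) ∧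
    (∀ p, (Es p).map (f.tangentMap 1 p).toLinearMap = Es (f.toHomeomorph p)) ∧
    0 < β ∧ β < 1 ∧ 1 < η ∧ 0 < C ∧
    (∀ p, ∀ v ∈ Eu p, ∀ n : ℕ, 1 / C * η ^ n * ‖v‖ ≤ ‖f.tangentMap n p v‖) ∧
    (∀ p, ∀ v ∈ Es p, ∀ n : ℕ, ‖f.tangentMap n p v‖ ≤ C * β ^ n * ‖v‖)

/-- `p` is a (Lyapunov) regular point of `f`, in the sense of Oseledets' theorem: all Lyapunov
exponents are defined at `p`. That is, there are numbers `χ₁ < ⋯ < χ_k` and a splitting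
`T_p 𝕋^d = E₁ ⊕ ⋯ ⊕ E_k` such that `(1/n) log ‖Df^n(p) v‖ → χ_i` as `n → ±∞` for all nonzero
`v ∈ E_i`, and `(1/n) log |det Df^n(p)| → ∑ χ_i dim E_i` as `n → ±∞`. -/
def IsRegularPoint (f : TorusDiffeo d) (p : Torus d) : Prop :=
  ∃ (k : ℕ) (χ : Fin k → ℝ) (E : Fin k → Submodule ℝ (Fin d → ℝ)),
    StrictMono χ ∧
    (∀ i, E i ≠ ⊥) ∧
    DirectSum.IsInternal E ∧
    (∀ i, ∀ v ∈ E i, v ≠ 0 →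
      Tendsto (fun n : ℤ => 1 / (n : ℝ) * Real.log ‖f.tangentMap n p v‖)
        (atTop ⊔ atBot) (𝓝 (χ i))) ∧
    Tendsto (fun n : ℤ => 1 / (n : ℝ) * Real.log |(f.tangentMap n p).det|)
      (atTop ⊔ atBot) (𝓝 (∑ i, χ i * (Module.finrank ℝ (E i) : ℝ)))

/-- The homeomorphism `h` conjugates `f` to `g`: `h ∘ f = g ∘ h`. -/
def IsConjugacy (h : Torus d ≃ₜ Torus d) (f g : TorusDiffeo d) : Prop :=
  ∀ p, h (f.toHomeomorph p) = g.toHomeomorph (h p)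

end TorusDiffeo

/-- The automorphism of the torus given by `M` is Anosov (hyperbolic): no complex eigenvalue of `M`
has modulus one. -/
def IsHyperbolicMatrix {d : ℕ} (M : GL (Fin d) ℤ) : Prop :=
  ∀ (z : ℂ) (v : Fin d → ℂ), v ≠ 0 → intAct M.val v = z • v → ‖z‖ ≠ 1

/-- `M` has `d` distinct eigenvalues, all of them real. -/
def HasSimpleRealSpectrum {d : ℕ} (M : GL (Fin d) ℤ) : Prop :=
  ∃ μ : Fin d → ℝ, Function.Injective μ ∧
    ∀ i, ∃ v : Fin d → ℝ, v ≠ 0 ∧ intAct M.val v = μ i • v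

/-- The point `(x, y)` of `V^d = V^2 × V^(d-2)`. -/
def pairCoord {d : ℕ} {V : Type*} (x : Fin 2 → V) (y : Fin (d - 2) → V) : Fin d → V :=
  fun i => if h : i.val < 2 then x ⟨i.val, h⟩ else y ⟨i.val - 2, by omega⟩

end

/-! Take `f(p) = M p + ψ(p) e`, where `M = A × B^3`, `e` is an eigenvector of `B^3` with eigenvalue
`σ > 1`, and `ψ = δ (1 - cos 2πx)` depends on one base coordinate only. The larger eigenvalue `μ` of
`A` is made so large that the moduli of the eigenvalues of `B^3` all lie strictly between `μ⁻¹` and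
`μ`. The inequality `σ < μ` is used twice, with opposite effects.

On derivatives it gives rigidity. `Df = M + dψ ⊗ e`, and a frame change `Id + c ⊗ e` with `c(e) = 0`
turns it into `M` exactly when `c_{f(p)} ∘ M = σ c_p + dψ_p`. Along the two eigencovectors of `A`
this splits into scalar equations, solved by geometric series of ratio `σ/μ` over the backward orbit
and `1/(σμ)` over the forward orbit. So `Df` is continuously conjugate to one constant diagonal
matrix (`exists_frame`). As the torus is compact, `f` is then Anosov and every point is regular,
with the exponents of `M` (`HasDiagonalFrame.isAnosov`, `HasDiagonalFrame.isRegularPoint`).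

On the conjugacy it destroys regularity. `p ↦ p + u(p) e` conjugates `f` to `M` when `σ u = u ∘ M +
ψ`. Since `u, ψ ≥ 0`, this yields `u(μ⁻¹ s w) ≥ σ⁻¹ u(s w)` on the unstable line of the base, hence
`u ≥ a σ^{-j}` at points whose distance from the fixed point `0` is of order `μ^{-j}`, while `u(0) =
0`. As `σ < μ`, `u` is not Lipschitz (`u_not_lipschitz`). Any other conjugacy to a linear map has a
lift that is an invertible affine map composed with this one (`conjugacy_rigidity`), because a
bounded orbit of a hyperbolic `M` on `ℝ^d` is zero; so no conjugacy is Lipschitz in either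
direction. -/

noncomputable section

/-! ### Integer vectors, the covering projection and the matrix action -/

section Basics

variable {d : ℕ}

/-- An integer vector, seen in `ℝ^d`. -/
def intVec (k : Fin d → ℤ) : Fin d → ℝ := fun i => (k i : ℝ)

theorem intVec_add (k l : Fin d → ℤ) : intVec (k + l) = intVec k + intVec l := by
  funext i
  simp [intVec]

theorem Torus.proj_add (x y : Fin d → ℝ) :
    Torus.proj (x + y) = Torus.proj x + Torus.proj y := by
  funext i
  simp [Torus.proj]

theorem Torus.proj_sub (x y : Fin d → ℝ) :
    Torus.proj (x - y) = Torus.proj x - Torus.proj y := by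
  funext i
  simp [Torus.proj]

theorem Torus.proj_zero : Torus.proj (0 : Fin d → ℝ) = 0 := by
  funext i
  simp [Torus.proj]

theorem Torus.continuous_proj : Continuous (Torus.proj (d := d)) :=
  continuous_pi fun i => (AddCircle.continuous_mk' (1 : ℝ)).comp (continuous_apply i)

theorem Torus.proj_intVec (k : Fin d → ℤ) : Torus.proj (intVec k) = 0 := by
  funext i
  simp only [Torus.proj, intVec, Pi.zero_apply]
  exact (AddCircle.coe_eq_zero_iff (1 : ℝ)).2 ⟨k i, by simp⟩

theorem Torus.proj_eq_iff {x y : Fin d → ℝ} :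
    Torus.proj x = Torus.proj y ↔ ∃ k, x - y = intVec k := by
  constructor
  · intro h
    have h1 : ∀ i, ∃ k : ℤ, (x - y) i = k := by
      intro i
      have h2 : (((x - y) i : ℝ) : UnitAddCircle) = 0 := by
        rw [Pi.sub_apply, AddCircle.coe_sub, sub_eq_zero]
        exact congrFun h i
      obtain ⟨k, hk⟩ := (AddCircle.coe_eq_zero_iff (1 : ℝ)).1 h2
      exact ⟨k, by simpa using hk.symm⟩
    choose k hk using h1
    exact ⟨k, funext hk⟩
  · rintro ⟨k, hk⟩
    rw [← sub_eq_zero, ← Torus.proj_sub, hk, Torus.proj_intVec]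

theorem Torus.norm_proj_le (x : Fin d → ℝ) : ‖Torus.proj x‖ ≤ ‖x‖ := by
  refine (pi_norm_le_iff_of_nonneg (norm_nonneg x)).2 fun i => ?_
  refine le_trans ?_ (norm_le_pi_norm x i)
  simp only [Torus.proj, UnitAddCircle.norm_eq, Real.norm_eq_abs]
  simpa using round_le (x i) 0

/-- The covering projection is isometric near `0`; this carries Lipschitz bounds from the torus back
to lifts. -/
theorem Torus.norm_proj_eq {x : Fin d → ℝ} (hx : ‖x‖ ≤ 1 / 2) : ‖Torus.proj x‖ = ‖x‖ := by
  have h : ∀ i, ‖Torus.proj x i‖ = ‖x i‖ := fun i =>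
    (AddCircle.norm_coe_eq_abs_iff (1 : ℝ) one_ne_zero).2
      (by simpa using (norm_le_pi_norm x i).trans hx)
  refine le_antisymm (Torus.norm_proj_le x) ?_
  refine (pi_norm_le_iff_of_nonneg (norm_nonneg _)).2 fun i => ?_
  rw [← h i]
  exact norm_le_pi_norm (Torus.proj x) i

theorem intAct_add {V : Type*} [AddCommGroup V] (M : Matrix (Fin d) (Fin d) ℤ)
    (v w : Fin d → V) : intAct M (v + w) = intAct M v + intAct M w := by
  funext i
  simp [intAct, Finset.sum_add_distrib]

theorem intAct_sub {V : Type*} [AddCommGroup V] (M : Matrix (Fin d) (Fin d) ℤ)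
    (v w : Fin d → V) : intAct M (v - w) = intAct M v - intAct M w := by
  funext i
  simp [intAct, smul_sub]

theorem intAct_zero {V : Type*} [AddCommGroup V] (M : Matrix (Fin d) (Fin d) ℤ) :
    intAct M (0 : Fin d → V) = 0 := by
  funext i
  simp [intAct]

theorem intAct_smul {R V : Type*} [AddCommGroup V] [Ring R] [Module R V]
    (M : Matrix (Fin d) (Fin d) ℤ) (c : R) (v : Fin d → V) :
    intAct M (c • v) = c • intAct M v := by
  funext i
  simp only [intAct, Pi.smul_apply, Finset.smul_sum]
  exact Finset.sum_congr rfl fun j _ => smul_comm _ _ _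

theorem intAct_intVec (M : Matrix (Fin d) (Fin d) ℤ) (k : Fin d → ℤ) :
    intAct M (intVec k) = intVec (intAct M k) := by
  funext i
  simp [intAct, intVec]

/-- The action of an integer matrix on `ℝ^d` as a continuous linear map. -/
def intActCLM (M : Matrix (Fin d) (Fin d) ℤ) : (Fin d → ℝ) →L[ℝ] (Fin d → ℝ) where
  toFun := intAct M
  map_add' := intAct_add M
  map_smul' := intAct_smul M
  cont := continuous_intAct M

@[simp] theorem intActCLM_apply (M : Matrix (Fin d) (Fin d) ℤ) (v : Fin d → ℝ) :
    intActCLM M v = intAct M v := rfl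

/-- A continuous function on `ℝ^d` whose norm is periodic is bounded. -/
theorem exists_bound_of_periodic {E : Type*} [SeminormedAddCommGroup E] {G : (Fin d → ℝ) → E}
    (hG : Continuous G) (hper : ∀ z k, ‖G (z + intVec k)‖ = ‖G z‖) :
    ∃ C, ∀ z, ‖G z‖ ≤ C := by
  obtain ⟨C, hC⟩ := (isCompact_Icc (a := (0 : Fin d → ℝ)) (b := 1)).exists_bound_of_continuousOn
    hG.continuousOn
  refine ⟨C, fun z => ?_⟩
  have h1 : ‖G z‖ = ‖G (fun i => Int.fract (z i))‖ := by
    rw [← hper (fun i => Int.fract (z i)) fun i => ⌊z i⌋]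
    congr 2
    funext i
    simp [intVec]
  rw [h1]
  exact hC _ ⟨fun i => Int.fract_nonneg _, fun i => (Int.fract_lt_one _).le⟩

/-- A continuous function on `ℝ^d` with values in `ℤ^d` is constant. -/
theorem eq_of_integer_valued {G : (Fin d → ℝ) → (Fin d → ℝ)} (hG : Continuous G)
    (hvals : ∀ z, ∃ k, G z = intVec k) (z w : Fin d → ℝ) : G z = G w := by
  funext i
  choose k hk using hvals
  have hkc : Continuous fun x => k x i := by
    rw [Int.isClosedEmbedding_coe_real.isEmbedding.continuous_iff]
    have : ((fun m : ℤ => (m : ℝ)) ∘ fun x => k x i) = fun x => G x i := by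
      funext x
      rw [hk]
      rfl
    rw [this]
    fun_prop
  rw [hk, hk]
  simp only [intVec]
  rw [PreconnectedSpace.constant inferInstance hkc]

/-- Two linear maps that agree on integer vectors are equal. -/
theorem clm_ext_intVec {S T : (Fin d → ℝ) →L[ℝ] (Fin d → ℝ)}
    (h : ∀ k : Fin d → ℤ, S (intVec k) = T (intVec k)) : S = T := by
  apply ContinuousLinearMap.coe_injective
  refine (Pi.basisFun ℝ (Fin d)).ext fun i => ?_
  have h1 : (Pi.basisFun ℝ (Fin d)) i = intVec (Pi.single i 1) := by
    funext j
    by_cases hj : j = i <;> simp [intVec, hj]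
  rw [h1]
  exact h _

/-- Every continuous self-map of the torus has a continuous lift `H` to `ℝ^d`, and
`H (z + k) = H z + P k` on integer vectors `k`, for a linear map `P` that preserves `ℤ^d`. -/
theorem exists_continuous_lift {h : Torus d → Torus d} (hh : Continuous h) :
    ∃ (H : (Fin d → ℝ) → (Fin d → ℝ)) (P : (Fin d → ℝ) →L[ℝ] (Fin d → ℝ)),
      Continuous H ∧ (∀ z, Torus.proj (H z) = h (Torus.proj z)) ∧
      (∀ z k, H (z + intVec k) = H z + P (intVec k)) ∧
      ∀ k, ∃ l, P (intVec k) = intVec l := by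
  have hlift : ∀ i, ∃ F : C((Fin d → ℝ), ℝ), ∀ z,
      ((F z : ℝ) : UnitAddCircle) = h (Torus.proj z) i := by
    intro i
    obtain ⟨e₀, he₀⟩ := QuotientAddGroup.mk_surjective (h (Torus.proj 0) i)
    obtain ⟨F, ⟨-, hF⟩, -⟩ :=
      (AddCircle.isCoveringMap_coe (1 : ℝ)).existsUnique_continuousMap_lifts
        ⟨fun z : Fin d → ℝ => h (Torus.proj z) i,
          (continuous_apply i).comp (hh.comp Torus.continuous_proj)⟩ 0 e₀ he₀
    exact ⟨F, fun z => congrFun hF z⟩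
  choose F hF using hlift
  set H : (Fin d → ℝ) → (Fin d → ℝ) := fun z i => F i z with hH
  have hHc : Continuous H := continuous_pi fun i => (F i).continuous
  have hHp : ∀ z, Torus.proj (H z) = h (Torus.proj z) := fun z => funext fun i => hF i z
  -- The increment over a period is integer valued and continuous in `z`, hence constant; it is
  -- additive in `k` and so extends from `ℤ^d` to a linear map `P`.
  have hvals : ∀ k z, ∃ l, H (z + intVec k) - H z = intVec l := by
    intro k z
    apply Torus.proj_eq_iff.1
    rw [hHp, hHp, Torus.proj_add, Torus.proj_intVec, add_zero]
  have hconst : ∀ k z, H (z + intVec k) - H z = H (0 + intVec k) - H 0 := fun k z =>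
    eq_of_integer_valued (G := fun z => H (z + intVec k) - H z) (by fun_prop) (hvals k) z 0
  let c : (Fin d → ℤ) →+ (Fin d → ℝ) :=
    { toFun := fun k => H (0 + intVec k) - H 0
      map_zero' := by
        have : intVec (0 : Fin d → ℤ) = 0 := by
          funext i
          simp [intVec]
        simp [this]
      map_add' := fun k l => by
        rw [← hconst l (0 + intVec k), intVec_add, ← add_assoc]
        abel }
  have hc : ∀ k, c k = H (0 + intVec k) - H 0 := fun _ => rfl
  let P : (Fin d → ℝ) →L[ℝ] (Fin d → ℝ) :=
    ∑ j, (ContinuousLinearMap.proj (R := ℝ) (φ := fun _ : Fin d => ℝ) j).smulRight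
      (c (Pi.single j 1))
  have hP : ∀ k, P (intVec k) = c k := by
    intro k
    have h1 : k = ∑ j, k j • (Pi.single j 1 : Fin d → ℤ) := by
      funext i
      simp [Finset.sum_apply, Pi.single_apply]
    have h2 : c k = ∑ j, k j • c (Pi.single j 1) := by
      conv_lhs => rw [h1]
      rw [map_sum]
      exact Finset.sum_congr rfl fun j _ => map_zsmul c _ _
    rw [h2]
    funext i
    simp [P, intVec]
  refine ⟨H, P, hHc, hHp, fun z k => ?_, fun k => ?_⟩
  · rw [hP, hc, ← hconst k z]
    abel
  · rw [hP, hc]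
    exact hvals k 0

end Basics

/-! ### Diffeomorphisms whose derivative is conjugate to a constant diagonal matrix -/

/-- A bounded error vanishes after division by `n` at both ends of `ℤ`. Compactness supplies such
errors for the logarithms of norms and determinants. -/
theorem tendsto_div_of_bounded {g : ℤ → ℝ} {χ K : ℝ} (h : ∀ n : ℤ, |g n - n * χ| ≤ K) :
    Tendsto (fun n : ℤ => 1 / (n : ℝ) * g n) (atTop ⊔ atBot) (𝓝 χ) := by
  have h0 : Tendsto (fun n : ℤ => 1 / (n : ℝ)) (atTop ⊔ atBot) (𝓝 0) := by
    simp only [one_div]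
    exact (tendsto_inv_atTop_zero.comp tendsto_intCast_atTop_atTop).sup
      (tendsto_inv_atBot_zero.comp (tendsto_intCast_atBot_iff.2 tendsto_id))
  have h1 : Tendsto (fun n : ℤ => 1 / (n : ℝ) * (g n - n * χ)) (atTop ⊔ atBot) (𝓝 0) := by
    refine squeeze_zero_norm (a := fun n : ℤ => |1 / (n : ℝ)| * K) (fun n => ?_) ?_
    · rw [norm_mul]
      exact mul_le_mul_of_nonneg_left (h n) (abs_nonneg _)
    · simpa using h0.abs.mul_const K
  have h2 : Tendsto (fun n : ℤ => 1 / (n : ℝ) * (g n - n * χ) + χ) (atTop ⊔ atBot) (𝓝 χ) := by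
    simpa using h1.add_const χ
  refine h2.congr' ?_
  have h3 : ∀ᶠ n : ℤ in atTop ⊔ atBot, n ≠ 0 :=
    eventually_sup.2 ⟨eventually_ne_atTop 0, eventually_ne_atBot 0⟩
  filter_upwards [h3] with n hn
  have : (n : ℝ) ≠ 0 := by exact_mod_cast hn
  field_simp
  ring

namespace TorusDiffeo

variable {d : ℕ}

theorem tangentMap_zero (f : TorusDiffeo d) (p : Torus d) :
    f.tangentMap 0 p = ContinuousLinearMap.id ℝ _ := by
  unfold tangentMap
  rw [zpow_zero, Equiv.Perm.coe_one]
  exact fderiv_id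

theorem tangentMap_add_one (f : TorusDiffeo d) (n : ℤ) (p : Torus d) :
    f.tangentMap (n + 1) p = (f.tangentMap n (f.toHomeomorph p)).comp (f.tangentMap 1 p) := by
  obtain ⟨x, rfl⟩ := Torus.proj_surjective d p
  rw [← f.proj_lift, tangentMap_proj, tangentMap_proj, tangentMap_proj, zpow_one, zpow_add_one,
    Equiv.Perm.coe_mul]
  exact fderiv_comp x ((f.contDiff_lift_zpow n).differentiable (by simp) _)
    (f.contDiff_lift.differentiable (by simp) _)

/-- A continuous frame `C p` of the tangent bundle (with inverse `C' p`) in which the derivative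
of `f` is the constant diagonal matrix with entries `ν`. -/
structure HasDiagonalFrame (f : TorusDiffeo d) (ν : Fin d → ℝ)
    (C C' : Torus d → (Fin d → ℝ) →L[ℝ] (Fin d → ℝ)) : Prop where
  ne_zero : ∀ i, ν i ≠ 0
  continuous_frame : Continuous C
  continuous_inv : Continuous C'
  left_inv : ∀ p v, C' p (C p v) = v
  right_inv : ∀ p v, C p (C' p v) = v
  map_frame : ∀ p v, f.tangentMap 1 p (C p v) = C (f.toHomeomorph p) (ν * v)

theorem exists_clm_bound {C : Torus d → (Fin d → ℝ) →L[ℝ] (Fin d → ℝ)} (hC : Continuous C) :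
    ∃ K : ℝ, 0 < K ∧ ∀ p v, ‖C p v‖ ≤ K * ‖v‖ := by
  obtain ⟨K, hK⟩ := isCompact_univ.exists_bound_of_continuousOn hC.continuousOn
  refine ⟨max K 1, by positivity, fun p v => ?_⟩
  refine ((C p).le_opNorm v).trans ?_
  gcongr
  exact (hK p (Set.mem_univ p)).trans (le_max_left _ _)

namespace HasDiagonalFrame

variable {f : TorusDiffeo d} {ν : Fin d → ℝ} {C C' : Torus d → (Fin d → ℝ) →L[ℝ] (Fin d → ℝ)}

/-- The point `q` is the `n`-th iterate of `p`, but all later bounds on the frame are uniform, so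
only its existence is recorded. -/
theorem tangentMap_frame (hf : f.HasDiagonalFrame ν C C') (n : ℤ) (p : Torus d) :
    ∃ q, ∀ v, f.tangentMap n p (C p v) = C q (ν ^ n * v) := by
  induction n using Int.induction_on generalizing p with
  | zero => exact ⟨p, fun v => by simp [tangentMap_zero]⟩
  | succ k ih =>
    obtain ⟨q, hq⟩ := ih (f.toHomeomorph p)
    refine ⟨q, fun v => ?_⟩
    rw [tangentMap_add_one, ContinuousLinearMap.comp_apply, hf.map_frame, hq]
    congr 1
    funext i
    simp only [Pi.mul_apply, Pi.pow_apply]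
    rw [zpow_add_one₀ (hf.ne_zero i)]
    ring
  | pred k ih =>
    obtain ⟨q, hq⟩ := ih (f.toHomeomorph.symm p)
    refine ⟨q, fun v => ?_⟩
    -- The chain rule is read backwards: `Df^{-k}` at `f⁻¹(p)` is `Df^{-k-1}(p)` after `Df`, and the
    -- input `ν⁻¹ v` cancels the factor `ν` produced by `Df`.
    have h1 := hq (ν⁻¹ * v)
    have h2 : (-(k : ℤ)) = (-(k : ℤ) - 1) + 1 := by ring
    rw [h2, tangentMap_add_one, ContinuousLinearMap.comp_apply, hf.map_frame,
      f.toHomeomorph.apply_symm_apply, ← h2] at h1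
    have h3 : ν * (ν⁻¹ * v) = v := by
      funext i
      simp [hf.ne_zero i]
    rw [h3] at h1
    rw [h1]
    congr 1
    funext i
    simp only [Pi.mul_apply, Pi.pow_apply, Pi.inv_apply]
    rw [zpow_sub_one₀ (hf.ne_zero i)]
    ring

theorem tangentMap_one_bijective (hf : f.HasDiagonalFrame ν C C') (p : Torus d) :
    Function.Bijective (f.tangentMap 1 p) := by
  have h : ∀ v, f.tangentMap 1 p v = C (f.toHomeomorph p) (ν * C' p v) := fun v => by
    rw [← hf.map_frame, hf.right_inv]
  constructor
  · intro v w hvw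
    rw [h, h] at hvw
    have h1 := congrArg (C' (f.toHomeomorph p)) hvw
    rw [hf.left_inv, hf.left_inv] at h1
    have h2 : C' p v = C' p w := by
      funext i
      have := congrFun h1 i
      simpa [hf.ne_zero i] using this
    rw [← hf.right_inv p v, h2, hf.right_inv]
  · intro w
    refine ⟨C p (ν⁻¹ * C' (f.toHomeomorph p) w), ?_⟩
    have h3 : ∀ v, ν * (ν⁻¹ * v) = v := fun v => by
      funext i
      simp [hf.ne_zero i]
    rw [hf.map_frame, h3, hf.right_inv]

/-- The Oseledets spaces are the lines spanned by the frame vectors, with exponents `log |ν i|`: the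
frame and its inverse are bounded on the compact torus, so they change `log ‖Df^n v‖` by a bounded
amount. -/
theorem isRegularPoint (hf : f.HasDiagonalFrame ν C C')
    (hν : Function.Injective fun i => |ν i|) (p : Torus d) : f.IsRegularPoint p := by
  obtain ⟨K, hK0, hK⟩ := exists_clm_bound hf.continuous_frame
  obtain ⟨K', hK'0, hK'⟩ := exists_clm_bound hf.continuous_inv
  have hdetC : ∀ q, (C q).det ≠ 0 := by
    intro q hq
    have h1 : (C' q).comp (C q) = ContinuousLinearMap.id ℝ _ := by
      ext1 v
      exact hf.left_inv q v
    have h2 := congrArg ContinuousLinearMap.det h1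
    simp only [ContinuousLinearMap.det, ContinuousLinearMap.toLinearMap_comp,
      LinearMap.det_comp] at h2 hq
    rw [hq] at h2
    simp at h2
  -- Regularity asks for increasing exponents, so the frame vectors are reordered by `τ`.
  set τ := Tuple.sort fun i => Real.log |ν i|
  have hinj : Function.Injective fun i => Real.log |ν i| := by
    intro i j hij
    exact hν (Real.log_injOn_pos (abs_pos.2 (hf.ne_zero i)) (abs_pos.2 (hf.ne_zero j)) hij)
  let w : Fin d → Fin d → ℝ := fun i => C p (Pi.single (τ i) 1)
  let Ce : (Fin d → ℝ) ≃ₗ[ℝ] (Fin d → ℝ) :=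
    { (C p).toLinearMap with
      invFun := C' p
      left_inv := hf.left_inv p
      right_inv := hf.right_inv p }
  let b : Module.Basis (Fin d) ℝ (Fin d → ℝ) := ((Pi.basisFun ℝ (Fin d)).map Ce).reindex τ.symm
  have hb : ∀ i, b i = w i := by
    intro i
    simp [b, w, Ce]
  have hbw : ⇑b = w := funext hb
  have hw0 : ∀ i, w i ≠ 0 := fun i => hb i ▸ b.ne_zero i
  have hlog : ∀ (i : Fin d) (n : ℤ), Real.log |ν i ^ n| = n * Real.log |ν i| := fun i n => by
    rw [abs_zpow, Real.log_zpow]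
  refine ⟨d, (fun i => Real.log |ν i|) ∘ τ, fun i => Submodule.span ℝ {w i},
    (Tuple.monotone_sort _).strictMono_of_injective (hinj.comp τ.injective), fun i => ?_,
    ?_, ?_, ?_⟩
  · simpa using hw0 i
  · apply DirectSum.isInternal_submodule_of_iSupIndep_of_iSup_eq_top
    · rw [← hbw]
      exact b.linearIndependent.iSupIndep_span_singleton
    · rw [← Submodule.span_range_eq_iSup, ← hbw, b.span_eq]
  · intro i v hv hv0
    obtain ⟨s, rfl⟩ := Submodule.mem_span_singleton.1 hv
    have hs : s ≠ 0 := fun h => hv0 (by simp [h])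
    have hone : ‖(Pi.single (τ i) 1 : Fin d → ℝ)‖ = 1 := by
      rw [Pi.norm_single, norm_one]
    -- Frame vectors have norm between `1 / K'` and `K` at every point.
    have hbd : ∀ q, -Real.log K' ≤ Real.log ‖C q (Pi.single (τ i) 1)‖ ∧
        Real.log ‖C q (Pi.single (τ i) 1)‖ ≤ Real.log K := by
      intro q
      have h1 := hK q (Pi.single (τ i) 1)
      have h2 := hK' q (C q (Pi.single (τ i) 1))
      rw [hf.left_inv, hone] at h2
      rw [hone, mul_one] at h1
      have h3 : 0 < ‖C q (Pi.single (τ i) 1)‖ := by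
        by_contra h
        have : ‖C q (Pi.single (τ i) 1)‖ = 0 := le_antisymm (not_lt.1 h) (norm_nonneg _)
        rw [this] at h2
        norm_num at h2
      refine ⟨?_, Real.log_le_log h3 h1⟩
      rw [← Real.log_inv]
      apply Real.log_le_log (by positivity)
      rw [inv_le_iff_one_le_mul₀ hK'0]
      linarith
    apply tendsto_div_of_bounded (K := abs (Real.log |s|) + (|Real.log K| + |Real.log K'|))
    intro n
    obtain ⟨q, hq⟩ := hf.tangentMap_frame n p
    have h1 : f.tangentMap n p (s • w i) = (s * ν (τ i) ^ n) • C q (Pi.single (τ i) 1) := by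
      have e : ν ^ n * Pi.single (τ i) 1 = ν (τ i) ^ n • (Pi.single (τ i) 1 : Fin d → ℝ) := by
        funext j
        by_cases hj : j = τ i
        · subst hj
          simp
        · simp [hj]
      simp only [w]
      rw [map_smul, hq, e, map_smul, mul_smul]
    have h3 : C q (Pi.single (τ i) 1) ≠ 0 := by
      intro h
      have := hf.left_inv q (Pi.single (τ i) 1)
      rw [h, map_zero] at this
      have h4 := congrFun this (τ i)
      simp at h4
    rw [h1, norm_smul, Real.norm_eq_abs, abs_mul, Real.log_mul
      (mul_ne_zero (abs_ne_zero.2 hs) (abs_ne_zero.2 (zpow_ne_zero _ (hf.ne_zero _))))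
      (norm_ne_zero_iff.2 h3), Real.log_mul (abs_ne_zero.2 hs)
      (abs_ne_zero.2 (zpow_ne_zero _ (hf.ne_zero _))), hlog]
    obtain ⟨h5, h6⟩ := hbd q
    have e1 : Real.log |s| + n * Real.log |ν (τ i)| + Real.log ‖C q (Pi.single (τ i) 1)‖
        - n * ((fun i => Real.log |ν i|) ∘ τ) i
        = Real.log |s| + Real.log ‖C q (Pi.single (τ i) 1)‖ := by
      simp only [Function.comp_apply]
      ring
    rw [e1]
    refine (abs_add_le _ _).trans (add_le_add le_rfl (abs_le.2 ⟨?_, ?_⟩))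
    · linarith [le_abs_self (Real.log K'), abs_nonneg (Real.log K)]
    · linarith [le_abs_self (Real.log K), abs_nonneg (Real.log K')]
  · have hfin : ∀ i, Module.finrank ℝ (Submodule.span ℝ {w i}) = 1 := fun i =>
      finrank_span_singleton (hw0 i)
    simp only [hfin, Nat.cast_one, mul_one]
    have hsum : ∑ i, ((fun i => Real.log |ν i|) ∘ τ) i = ∑ i, Real.log |ν i| :=
      Equiv.sum_comp τ fun i => Real.log |ν i|
    rw [hsum]
    have hcont : Continuous fun q => Real.log |(C q).det| := by
      refine Continuous.log ?_ fun q => abs_ne_zero.2 (hdetC q)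
      exact (ContinuousLinearMap.continuous_det.comp hf.continuous_frame).abs
    obtain ⟨R, hR⟩ := isCompact_univ.exists_bound_of_continuousOn hcont.continuousOn
    apply tendsto_div_of_bounded (K := R + R)
    intro n
    obtain ⟨q, hq⟩ := hf.tangentMap_frame n p
    -- Taking determinants here leaves the error `log |det C q| - log |det C p|`, bounded by
    -- compactness.
    have h1 : (f.tangentMap n p).toLinearMap ∘ₗ (C p).toLinearMap =
        (C q).toLinearMap ∘ₗ Matrix.toLin' (Matrix.diagonal (ν ^ n)) := by
      ext1 i
      ext1
      simp only [LinearMap.comp_apply, ContinuousLinearMap.coe_coe, Matrix.toLin'_apply]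
      rw [hq]
      congr 2
      funext j
      simp [Matrix.mulVec_diagonal]
    have h2 := congrArg LinearMap.det h1
    rw [LinearMap.det_comp, LinearMap.det_comp, LinearMap.det_toLin', Matrix.det_diagonal] at h2
    have h3 : (f.tangentMap n p).det * (C p).det = (C q).det * ∏ i, ν i ^ n := h2
    have hprod : (∏ i, ν i ^ n) ≠ 0 :=
      Finset.prod_ne_zero_iff.2 fun i _ => zpow_ne_zero _ (hf.ne_zero i)
    have h4 : (f.tangentMap n p).det ≠ 0 := by
      intro h
      rw [h, zero_mul] at h3
      exact mul_ne_zero (hdetC q) hprod h3.symm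
    have h5 := congrArg (fun x => Real.log |x|) h3
    simp only [abs_mul] at h5
    rw [Real.log_mul (abs_ne_zero.2 h4) (abs_ne_zero.2 (hdetC p)),
      Real.log_mul (abs_ne_zero.2 (hdetC q)) (abs_ne_zero.2 hprod), Finset.abs_prod,
      Real.log_prod fun i _ => abs_ne_zero.2 (zpow_ne_zero _ (hf.ne_zero i))] at h5
    simp only [hlog] at h5
    rw [← Finset.mul_sum] at h5
    have h6 : Real.log |(f.tangentMap n p).det| - n * ∑ i, Real.log |ν i| =
        Real.log |(C q).det| - Real.log |(C p).det| := by linarith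
    rw [h6]
    exact (abs_sub _ _).trans (add_le_add (hR q (Set.mem_univ q)) (hR p (Set.mem_univ p)))

end HasDiagonalFrame

end TorusDiffeo

/-! ### The hyperbolic splitting given by a diagonal frame -/

namespace TorusDiffeo.HasDiagonalFrame

variable {d : ℕ} {f : TorusDiffeo d} {ν : Fin d → ℝ}
  {C C' : Torus d → (Fin d → ℝ) →L[ℝ] (Fin d → ℝ)}

/-- The projection of `ℝ^d` onto the coordinates `i` with `1 < |ν i|`. -/
def expandingProj (ν : Fin d → ℝ) : (Fin d → ℝ) →L[ℝ] (Fin d → ℝ) :=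
  ContinuousLinearMap.pi fun i =>
    (if 1 < |ν i| then (1 : ℝ) else 0) • ContinuousLinearMap.proj (R := ℝ) i

theorem expandingProj_apply (ν v : Fin d → ℝ) (i : Fin d) :
    expandingProj ν v i = if 1 < |ν i| then v i else 0 := by
  simp only [expandingProj, ContinuousLinearMap.pi_apply, smul_apply,
    ContinuousLinearMap.proj_apply, smul_eq_mul, ite_mul, one_mul, zero_mul]

/-- Transporting the coordinate projection onto the expanding indices by the frame gives a
continuous projection that commutes with `Df`, so its range and kernel are invariant. The frame
distorts norms by `K` and `K'`, whence the constant `K * K'`. -/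
theorem isAnosov (hf : f.HasDiagonalFrame ν C C') (hν : ∀ i, |ν i| ≠ 1) : f.IsAnosov := by
  obtain ⟨K, hK0, hK⟩ := exists_clm_bound hf.continuous_frame
  obtain ⟨K', hK'0, hK'⟩ := exists_clm_bound hf.continuous_inv
  let P : Torus d → ((Fin d → ℝ) →L[ℝ] (Fin d → ℝ)) := fun p =>
    (C p).comp ((expandingProj ν).comp (C' p))
  have hPdef : ∀ p v, P p v = C p (expandingProj ν (C' p v)) := fun p v => rfl
  have hidem0 : ∀ v, expandingProj ν (expandingProj ν v) = expandingProj ν v := by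
    intro v
    funext i
    simp only [expandingProj_apply]
    split_ifs <;> rfl
  have hidem : ∀ p v, P p (P p v) = P p v := by
    intro p v
    rw [hPdef, hPdef, hf.left_inv, hidem0]
  have hcomm : ∀ p v, f.tangentMap 1 p (P p v) = P (f.toHomeomorph p) (f.tangentMap 1 p v) := by
    intro p v
    have h1 : f.tangentMap 1 p v = C (f.toHomeomorph p) (ν * C' p v) := by
      rw [← hf.map_frame, hf.right_inv]
    rw [h1, hPdef, hPdef, hf.map_frame, hf.left_inv]
    congr 1
    funext i
    simp only [Pi.mul_apply, expandingProj_apply]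
    split_ifs <;> simp
  have hrange : ∀ p v, v ∈ LinearMap.range (P p).toLinearMap ↔ P p v = v := by
    intro p v
    constructor
    · rintro ⟨w, rfl⟩
      exact hidem p w
    · intro h
      exact ⟨v, h⟩
  have hker : ∀ p v, v ∈ LinearMap.ker (P p).toLinearMap ↔ P p v = 0 := fun p v => Iff.rfl
  -- A rate close enough to `1` works for the finitely many indices; this also covers the case of no
  -- expanding index.
  obtain ⟨η, hη1, hη⟩ : ∃ η : ℝ, 1 < η ∧ ∀ i, 1 < |ν i| → η ≤ |ν i| := by
    have h : ∀ᶠ η : ℝ in 𝓝[>] 1, 1 < η ∧ ∀ i, 1 < |ν i| → η ≤ |ν i| := by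
      refine (eventually_mem_nhdsWithin).and (eventually_all.2 fun i => ?_)
      by_cases h : 1 < |ν i|
      · filter_upwards [Ioo_mem_nhdsGT h] with η hη _ using hη.2.le
      · exact Eventually.of_forall fun _ h' => absurd h' h
    exact h.exists
  obtain ⟨β, hβ0, hβ1, hβ⟩ : ∃ β : ℝ, 0 < β ∧ β < 1 ∧ ∀ i, |ν i| < 1 → |ν i| ≤ β := by
    have h : ∀ᶠ β : ℝ in 𝓝[<] 1, 0 < β ∧ β < 1 ∧ ∀ i, |ν i| < 1 → |ν i| ≤ β := by
      have h0 : ∀ᶠ β : ℝ in 𝓝[<] 1, 0 < β ∧ β < 1 := Ioo_mem_nhdsLT one_pos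
      have h1 : ∀ᶠ β : ℝ in 𝓝[<] 1, ∀ i, |ν i| < 1 → |ν i| ≤ β := by
        refine eventually_all.2 fun i => ?_
        by_cases h : |ν i| < 1
        · filter_upwards [Ioo_mem_nhdsLT h] with β hβ _ using hβ.1.le
        · exact Eventually.of_forall fun _ h' => absurd h' h
      filter_upwards [h0, h1] with β h2 h3 using ⟨h2.1, h2.2, h3⟩
    exact h.exists
  refine ⟨fun p => LinearMap.range (P p).toLinearMap, fun p => LinearMap.ker (P p).toLinearMap,
    P, β, η, K * K', ?_, ?_, fun p v hv => (hrange p v).1 hv, fun p v hv => (hker p v).1 hv, ?_, ?_,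
    hβ0, hβ1, hη1, by positivity, ?_, ?_⟩
  · intro p
    refine IsCompl.of_eq ?_ ?_
    · rw [eq_bot_iff]
      rintro v ⟨h1, h2⟩
      have h3 := (hrange p v).1 h1
      have h4 := (hker p v).1 h2
      rw [Submodule.mem_bot, ← h3, h4]
    · rw [eq_top_iff]
      intro v _
      refine Submodule.mem_sup.2 ⟨P p v, ⟨v, rfl⟩, v - P p v, ?_, by simp⟩
      rw [hker, map_sub, hidem, sub_self]
  · exact hf.continuous_frame.clm_comp (continuous_const.clm_comp hf.continuous_inv)
  · intro p
    ext w
    constructor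
    · rintro ⟨v, hv, rfl⟩
      rw [SetLike.mem_coe, hrange] at hv
      rw [hrange, ContinuousLinearMap.coe_coe, ← hcomm, hv]
    · intro hw
      obtain ⟨v, rfl⟩ := (hf.tangentMap_one_bijective p).2 w
      rw [hrange, ← hcomm] at hw
      exact ⟨v, (hrange p v).2 ((hf.tangentMap_one_bijective p).1 hw), rfl⟩
  · intro p
    ext w
    constructor
    · rintro ⟨v, hv, rfl⟩
      rw [SetLike.mem_coe, hker] at hv
      rw [hker, ContinuousLinearMap.coe_coe, ← hcomm, hv, map_zero]
    · intro hw
      obtain ⟨v, rfl⟩ := (hf.tangentMap_one_bijective p).2 w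
      rw [hker, ← hcomm] at hw
      refine ⟨v, (hker p v).2 ((hf.tangentMap_one_bijective p).1 ?_), rfl⟩
      rw [hw, map_zero]
  · intro p v hv n
    rw [hrange] at hv
    have hv' : expandingProj ν (C' p v) = C' p v := by
      rw [← hf.left_inv p (expandingProj ν (C' p v)), ← hPdef, hv]
    obtain ⟨q, hq⟩ := hf.tangentMap_frame n p
    have h1 : f.tangentMap n p v = C q (ν ^ (n : ℤ) * C' p v) := by
      rw [← hq, hf.right_inv]
    have h2 : η ^ n * ‖C' p v‖ ≤ ‖ν ^ (n : ℤ) * C' p v‖ := by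
      rw [← Real.norm_of_nonneg (pow_nonneg (by linarith : (0 : ℝ) ≤ η) n), ← norm_smul]
      refine (pi_norm_le_iff_of_nonneg (norm_nonneg _)).2 fun i => ?_
      refine le_trans ?_ (norm_le_pi_norm (ν ^ (n : ℤ) * C' p v) i)
      simp only [Pi.smul_apply, Pi.mul_apply, Pi.pow_apply, smul_eq_mul, norm_mul, zpow_natCast,
        norm_pow]
      by_cases hi : 1 < |ν i|
      · gcongr
        rw [Real.norm_of_nonneg (by linarith)]
        exact hη i hi
      · have : C' p v i = 0 := by
          rw [← hv', expandingProj_apply, if_neg hi]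
        simp [this]
    have h3 : ‖v‖ ≤ K * ‖C' p v‖ := by
      conv_lhs => rw [← hf.right_inv p v]
      exact hK p _
    have h4 : ‖ν ^ (n : ℤ) * C' p v‖ ≤ K' * ‖f.tangentMap n p v‖ := by
      rw [h1]
      conv_lhs => rw [← hf.left_inv q (ν ^ (n : ℤ) * C' p v)]
      exact hK' q _
    have hη0 : 0 < η ^ n := pow_pos (by linarith) n
    have h5 : η ^ n * ‖v‖ ≤ K * K' * ‖f.tangentMap n p v‖ := by
      calc η ^ n * ‖v‖ ≤ η ^ n * (K * ‖C' p v‖) := by gcongr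
        _ = K * (η ^ n * ‖C' p v‖) := by ring
        _ ≤ K * (K' * ‖f.tangentMap n p v‖) :=
          mul_le_mul_of_nonneg_left (h2.trans h4) hK0.le
        _ = K * K' * ‖f.tangentMap n p v‖ := by ring
    rw [mul_assoc, one_div, inv_mul_le_iff₀ (by positivity)]
    exact h5
  · intro p v hv n
    rw [hker] at hv
    have hv' : expandingProj ν (C' p v) = 0 := by
      rw [← hf.left_inv p (expandingProj ν (C' p v)), ← hPdef, hv, map_zero]
    obtain ⟨q, hq⟩ := hf.tangentMap_frame n p
    have h1 : f.tangentMap n p v = C q (ν ^ (n : ℤ) * C' p v) := by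
      rw [← hq, hf.right_inv]
    have h2 : ‖ν ^ (n : ℤ) * C' p v‖ ≤ β ^ n * ‖C' p v‖ := by
      refine (pi_norm_le_iff_of_nonneg (by positivity)).2 fun i => ?_
      simp only [Pi.mul_apply, Pi.pow_apply, norm_mul, zpow_natCast, norm_pow]
      by_cases hi : 1 < |ν i|
      · have := congrFun hv' i
        rw [expandingProj_apply, if_pos hi, Pi.zero_apply] at this
        rw [this, norm_zero, mul_zero]
        positivity
      · have hi' : |ν i| < 1 := lt_of_le_of_ne (not_lt.1 hi) (hν i)
        gcongr
        · exact hβ i hi'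
        · exact norm_le_pi_norm (C' p v) i
    calc ‖f.tangentMap n p v‖ ≤ K * ‖ν ^ (n : ℤ) * C' p v‖ := h1 ▸ hK q _
      _ ≤ K * (β ^ n * (K' * ‖v‖)) := by
        gcongr
        refine h2.trans ?_
        gcongr
        exact hK' p v
      _ = K * K' * β ^ n * ‖v‖ := by ring

end TorusDiffeo.HasDiagonalFrame

/-! ### The bump function and the cohomological equation -/

theorem periodic_oneSubCos : Function.Periodic (fun x : ℝ => 1 - Real.cos (2 * Real.pi * x)) 1 := by
  intro x
  simp [mul_add]

/-- The function `1 - cos (2πx)` on the circle. -/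
def circleOneSubCos (x : UnitAddCircle) : ℝ := periodic_oneSubCos.lift x

theorem circleOneSubCos_coe (x : ℝ) :
    circleOneSubCos (x : UnitAddCircle) = 1 - Real.cos (2 * Real.pi * x) :=
  periodic_oneSubCos.lift_coe x

theorem continuous_circleOneSubCos : Continuous circleOneSubCos :=
  continuous_coinduced_dom.2 (by
    change Continuous fun x : ℝ => 1 - Real.cos (2 * Real.pi * x)
    fun_prop)

/-- Positivity of the bump, with its zero at `0`, is what allows the displacement `u` of the
conjugacy to be bounded below. -/
theorem circleOneSubCos_nonneg (x : UnitAddCircle) : 0 ≤ circleOneSubCos x := by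
  obtain ⟨y, rfl⟩ := QuotientAddGroup.mk_surjective x
  rw [circleOneSubCos_coe]
  linarith [Real.cos_le_one (2 * Real.pi * y)]

theorem circleOneSubCos_zero : circleOneSubCos 0 = 0 := by
  simpa using circleOneSubCos_coe 0

theorem periodic_sin_two_pi : Function.Periodic (fun x : ℝ => Real.sin (2 * Real.pi * x)) 1 := by
  intro x
  simp [mul_add]

/-- The function `sin (2πx)` on the circle. -/
def circleSin (x : UnitAddCircle) : ℝ := periodic_sin_two_pi.lift x

theorem circleSin_coe (x : ℝ) : circleSin (x : UnitAddCircle) = Real.sin (2 * Real.pi * x) :=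
  periodic_sin_two_pi.lift_coe x

theorem continuous_circleSin : Continuous circleSin :=
  continuous_coinduced_dom.2 (by
    change Continuous fun x : ℝ => Real.sin (2 * Real.pi * x)
    fun_prop)

section Cohomological

variable {X : Type*} [TopologicalSpace X] [CompactSpace X]

/-- The bounded solution `a` of `a = ρ · a ∘ T + g`, for `|ρ| < 1`. -/
def cohomSol {X : Type*} (ρ : ℝ) (T : X → X) (g : X → ℝ) (x : X) : ℝ := ∑' j : ℕ, ρ ^ j * g (T^[j] x)

variable {ρ : ℝ} {T : X → X} {g : X → ℝ}

/-- The bound is uniform in `x`, so it serves both summability and continuity of the sum. -/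
theorem exists_cohom_bound (hg : Continuous g) :
    ∃ K : ℝ, ∀ (j : ℕ) (x : X), ‖ρ ^ j * g (T^[j] x)‖ ≤ |ρ| ^ j * K := by
  obtain ⟨K, hK⟩ := isCompact_univ.exists_bound_of_continuousOn hg.continuousOn
  refine ⟨K, fun j x => ?_⟩
  rw [norm_mul, norm_pow, Real.norm_eq_abs ρ]
  gcongr
  exact hK _ (Set.mem_univ _)

theorem summable_cohom (hρ : |ρ| < 1) (hg : Continuous g) (x : X) :
    Summable fun j : ℕ => ρ ^ j * g (T^[j] x) := by
  obtain ⟨K, hK⟩ := exists_cohom_bound (ρ := ρ) (T := T) hg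
  exact Summable.of_norm_bounded
    ((summable_geometric_of_lt_one (abs_nonneg ρ) hρ).mul_right K) fun j => hK j x

theorem continuous_cohomSol (hρ : |ρ| < 1) (hT : Continuous T) (hg : Continuous g) :
    Continuous (cohomSol ρ T g) := by
  obtain ⟨K, hK⟩ := exists_cohom_bound (ρ := ρ) (T := T) hg
  exact continuous_tsum (fun j => continuous_const.mul (hg.comp (hT.iterate j)))
    ((summable_geometric_of_lt_one (abs_nonneg ρ) hρ).mul_right K) hK

theorem cohomSol_eq (hρ : |ρ| < 1) (hg : Continuous g) (x : X) :
    cohomSol ρ T g x = ρ * cohomSol ρ T g (T x) + g x := by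
  unfold cohomSol
  rw [(summable_cohom hρ hg x).tsum_eq_zero_add, ← tsum_mul_left, add_comm]
  congr 1
  · refine tsum_congr fun j => ?_
    rw [Function.iterate_succ_apply]
    ring
  · simp

end Cohomological

theorem cohomSol_nonneg {X : Type*} {ρ : ℝ} {T : X → X} {g : X → ℝ} (hρ : 0 ≤ ρ) (hg : ∀ x, 0 ≤ g x) (x : X) : 0 ≤ cohomSol ρ T g x :=
  tsum_nonneg fun j => mul_nonneg (pow_nonneg hρ j) (hg _)

/-! ### The skew product -/

/-- An automorphism `M` of `𝕋^d` with simple real hyperbolic spectrum, diagonalized by `E`, which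
acts on the coordinates `i₀, i₁` by the matrix `(t, -1; 1, 0)` with eigenvalues `μ, μ⁻¹`, together
with an eigenvector `e` in the complementary coordinates whose eigenvalue `σ` is dominated
by `μ`. -/
structure SkewModel (d : ℕ) where
  M : GL (Fin d) ℤ
  t : ℤ
  μ : ℝ
  σ : ℝ
  i₀ : Fin d
  i₁ : Fin d
  e : Fin d → ℝ
  w : Fin d → ℝ
  ν : Fin d → ℝ
  E : (Fin d → ℝ) →L[ℝ] (Fin d → ℝ)
  E' : (Fin d → ℝ) →L[ℝ] (Fin d → ℝ)
  one_lt_σ : 1 < σ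
  σ_lt_μ : σ < μ
  trace_eq : t * μ = μ ^ 2 + 1
  act_i₀ : ∀ v : Fin d → ℝ, intAct M.val v i₀ = t * v i₀ - v i₁
  act_i₁ : ∀ v : Fin d → ℝ, intAct M.val v i₁ = v i₀
  e_i₀ : e i₀ = 0
  e_i₁ : e i₁ = 0
  e_ne_zero : e ≠ 0
  act_e : intAct M.val e = σ • e
  act_w : intAct M.val w = μ • w
  w_i₀ : w i₀ ≠ 0
  left_inv : ∀ v, E' (E v) = v
  right_inv : ∀ v, E (E' v) = v
  act_E : ∀ v, intAct M.val (E v) = E (ν * v)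
  ν_ne_zero : ∀ i, ν i ≠ 0
  ν_ne_one : ∀ i, |ν i| ≠ 1
  ν_inj : Function.Injective fun i => |ν i|

namespace SkewModel

variable {d : ℕ} (S : SkewModel d)

theorem σ_pos : 0 < S.σ := one_pos.trans S.one_lt_σ

theorem μ_pos : 0 < S.μ := S.σ_pos.trans S.σ_lt_μ

theorem act_smul_e (c : ℝ) : intAct S.M.val (c • S.e) = (S.σ * c) • S.e := by
  rw [intAct_smul, S.act_e, smul_smul, mul_comm]

theorem inv_act_smul_e (c : ℝ) : intAct S.M.inv (c • S.e) = (S.σ⁻¹ * c) • S.e := by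
  have h := congrArg (intAct S.M.inv) (S.act_smul_e (S.σ⁻¹ * c))
  rw [← intAct_mul, S.M.inv_val, intAct_one, ← mul_assoc, mul_inv_cancel₀ S.σ_pos.ne',
    one_mul] at h
  exact h.symm

theorem act_inv_act {V : Type*} [AddCommGroup V] (v : Fin d → V) :
    intAct S.M.val (intAct S.M.inv v) = v := by
  rw [← intAct_mul, S.M.val_inv, intAct_one]

theorem inv_act_act {V : Type*} [AddCommGroup V] (v : Fin d → V) :
    intAct S.M.inv (intAct S.M.val v) = v := by
  rw [← intAct_mul, S.M.inv_val, intAct_one]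

theorem proj_act_smul_e (c : ℝ) :
    intAct S.M.val (Torus.proj (c • S.e)) = Torus.proj ((S.σ * c) • S.e) := by
  rw [← proj_intAct, act_smul_e]

theorem proj_inv_act_smul_e (c : ℝ) :
    intAct S.M.inv (Torus.proj (c • S.e)) = Torus.proj ((S.σ⁻¹ * c) • S.e) := by
  rw [← proj_intAct, inv_act_smul_e]

theorem proj_smul_e_i₀ (c : ℝ) : Torus.proj (c • S.e) S.i₀ = 0 := by
  simp [Torus.proj, S.e_i₀]

/-- The fibre translation as a function on the torus. -/
def ψ (δ : ℝ) (p : Torus d) : ℝ := δ * circleOneSubCos (p S.i₀)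

theorem continuous_ψ (δ : ℝ) : Continuous (S.ψ δ) :=
  continuous_const.mul (continuous_circleOneSubCos.comp (continuous_apply _))

/-- Invariance along `e` is what makes the skew product explicitly invertible. -/
theorem ψ_add (δ c : ℝ) (p : Torus d) : S.ψ δ (p + Torus.proj (c • S.e)) = S.ψ δ p := by
  simp [ψ, S.proj_smul_e_i₀]

theorem ψ_sub (δ c : ℝ) (p : Torus d) : S.ψ δ (p - Torus.proj (c • S.e)) = S.ψ δ p := by
  simp [ψ, S.proj_smul_e_i₀]

theorem ψ_proj (δ : ℝ) (z : Fin d → ℝ) :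
    S.ψ δ (Torus.proj z) = δ * (1 - Real.cos (2 * Real.pi * z S.i₀)) := by
  rw [ψ]
  simp only [Torus.proj]
  rw [circleOneSubCos_coe]

theorem contDiff_ψ_proj (δ : ℝ) : ContDiff ℝ ∞ fun z : Fin d → ℝ => S.ψ δ (Torus.proj z) := by
  simp only [ψ_proj]
  fun_prop

theorem ψ_zero (δ : ℝ) : S.ψ δ 0 = 0 := by
  simp [ψ, circleOneSubCos_zero]

/-- The diffeomorphism `p ↦ M p + ψ(p) e`. -/
def skew (δ : ℝ) : TorusDiffeo d where
  toHomeomorph :=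
    { toFun := fun p => intAct S.M.val p + Torus.proj (S.ψ δ p • S.e)
      -- Solving `q = M p + ψ(p) e` gives `p = M⁻¹ q - σ⁻¹ ψ(p) e`, and `ψ(p) = ψ(M⁻¹ q)` because
      -- the two points differ along `e`.
      invFun := fun p =>
        intAct S.M.inv p - Torus.proj ((S.σ⁻¹ * S.ψ δ (intAct S.M.inv p)) • S.e)
      left_inv := fun p => by
        simp only [intAct_add, inv_act_act, proj_inv_act_smul_e, ψ_add]
        abel
      right_inv := fun p => by
        simp only [intAct_sub, act_inv_act, proj_act_smul_e, ψ_sub]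
        rw [← mul_assoc, mul_inv_cancel₀ S.σ_pos.ne', one_mul]
        abel
      continuous_toFun := (continuous_intAct _).add
        (Torus.continuous_proj.comp ((S.continuous_ψ δ).smul continuous_const))
      continuous_invFun := (continuous_intAct _).sub
        (Torus.continuous_proj.comp ((continuous_const.mul
          ((S.continuous_ψ δ).comp (continuous_intAct _))).smul continuous_const)) }
  lift :=
    { toFun := fun z => intAct S.M.val z + S.ψ δ (Torus.proj z) • S.e
      invFun := fun z =>
        intAct S.M.inv z - (S.σ⁻¹ * S.ψ δ (Torus.proj (intAct S.M.inv z))) • S.e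
      left_inv := fun z => by
        simp only [intAct_add, inv_act_act, inv_act_smul_e, Torus.proj_add, ψ_add]
        abel
      right_inv := fun z => by
        simp only [intAct_sub, act_inv_act, act_smul_e, Torus.proj_sub, ψ_sub]
        rw [← mul_assoc, mul_inv_cancel₀ S.σ_pos.ne', one_mul]
        abel }
  contDiff_lift := (contDiff_intAct _).add ((S.contDiff_ψ_proj δ).smul contDiff_const)
  contDiff_lift_symm := (contDiff_intAct _).sub
    ((contDiff_const.mul ((S.contDiff_ψ_proj δ).comp (contDiff_intAct _))).smul contDiff_const)
  proj_lift z := by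
    change Torus.proj (_ + _) = intAct _ _ + _
    rw [Torus.proj_add, proj_intAct]

theorem skew_apply (δ : ℝ) (p : Torus d) :
    (S.skew δ).toHomeomorph p = intAct S.M.val p + Torus.proj (S.ψ δ p • S.e) := rfl

theorem skew_lift (δ : ℝ) (z : Fin d → ℝ) :
    (S.skew δ).lift z = intAct S.M.val z + S.ψ δ (Torus.proj z) • S.e := rfl

theorem isLinearization_skew (δ : ℝ) : (S.skew δ).IsLinearization S.M := by
  intro x k
  have h := intAct_intVec S.M.val k
  rw [skew_lift, skew_lift]
  change intAct S.M.val (x + intVec k) + S.ψ δ (Torus.proj (x + intVec k)) • S.e =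
    _ + intVec (intAct S.M.val k)
  rw [intAct_add, h, Torus.proj_add, Torus.proj_intVec, add_zero]
  abel

/-- The skew products converge to the linear automorphism in the `C^∞` topology. -/
theorem exists_crClose (r : ℕ) {ε : ℝ} (hε : 0 < ε) :
    ∃ δ : ℝ, 0 < δ ∧ TorusDiffeo.CrClose r ε (S.skew δ) (TorusDiffeo.linear S.M) := by
  set G : (Fin d → ℝ) → (Fin d → ℝ) := fun z => S.ψ 1 (Torus.proj z) • S.e with hG
  have hGs : ContDiff ℝ ∞ G := (S.contDiff_ψ_proj 1).smul contDiff_const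
  have hb : ∀ k : ℕ, ∃ K, ∀ z, ‖iteratedFDeriv ℝ k G z‖ ≤ K := by
    intro k
    apply exists_bound_of_periodic
    · exact hGs.continuous_iteratedFDeriv (by exact_mod_cast le_top)
    · intro z l
      rw [← iteratedFDeriv_comp_add_right]
      have : (fun z => G (z + intVec l)) = G := by
        funext z
        simp only [hG, Torus.proj_add, Torus.proj_intVec, add_zero]
      rw [this]
  choose K hK using hb
  set R := ∑ k ∈ Finset.range (r + 1), |K k| with hR
  have hR0 : 0 ≤ R := Finset.sum_nonneg fun _ _ => abs_nonneg _
  -- The perturbation is linear in `δ`, and `R` bounds its derivatives up to order `r` at `δ = 1`.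
  -- The lifts need no integer correction.
  refine ⟨ε / (R + 1), by positivity, 0, fun k hk x => ?_⟩
  have h1 : (fun z => (S.skew (ε / (R + 1))).lift z - (TorusDiffeo.linear S.M).lift z -
      fun i => (((0 : Fin d → ℤ) i : ℤ) : ℝ)) = (ε / (R + 1)) • G := by
    funext z i
    have : (TorusDiffeo.linear S.M).lift z = intAct S.M.val z := rfl
    rw [this, skew_lift]
    simp [hG, ψ]
    ring
  rw [h1, iteratedFDeriv_const_smul_apply (hGs.of_le (by exact_mod_cast le_top)).contDiffAt,
    norm_smul, Real.norm_of_nonneg (by positivity)]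
  have h2 : ‖iteratedFDeriv ℝ k G x‖ ≤ R :=
    (hK k x).trans ((le_abs_self _).trans (Finset.single_le_sum (f := fun k => |K k|)
      (fun _ _ => abs_nonneg _) (Finset.mem_range.2 (by omega))))
  calc ε / (R + 1) * ‖iteratedFDeriv ℝ k G x‖ ≤ ε / (R + 1) * R := by gcongr
    _ < ε := by
      rw [div_mul_eq_mul_div, div_lt_iff₀ (by linarith)]
      nlinarith

/-! ### The invariant frame -/

theorem tangentMap_skew (δ : ℝ) (p : Torus d) (v : Fin d → ℝ) :
    (S.skew δ).tangentMap 1 p v = intAct S.M.val v +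
      (δ * (2 * Real.pi) * circleSin (p S.i₀) * v S.i₀) • S.e := by
  obtain ⟨z, rfl⟩ := Torus.proj_surjective d p
  rw [TorusDiffeo.tangentMap_proj, zpow_one]
  have h0 : HasFDerivAt (fun z : Fin d → ℝ => z S.i₀)
      (ContinuousLinearMap.proj (R := ℝ) (φ := fun _ : Fin d => ℝ) S.i₀) z :=
    (ContinuousLinearMap.proj (R := ℝ) (φ := fun _ : Fin d => ℝ) S.i₀).hasFDerivAt
  have h1 := (((h0.const_mul (2 * Real.pi)).cos).const_sub 1).const_mul δ
  have h2 := ((intActCLM S.M.val).hasFDerivAt (x := z)).add (h1.smul_const S.e)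
  have h3 : ((S.skew δ).lift : (Fin d → ℝ) → (Fin d → ℝ)) = ⇑(intActCLM S.M.val) +
      fun z => (δ * (1 - Real.cos (2 * Real.pi * z S.i₀))) • S.e := by
    funext z
    rw [skew_lift, ψ_proj]
    rfl
  rw [h3, h2.fderiv]
  simp only [Torus.proj, circleSin_coe]
  simp
  ring_nf

/-- The covector on the coordinates `i₀, i₁` with eigenvalue `c`, when `c` is `μ` or `μ⁻¹`. -/
def covec (c : ℝ) : (Fin d → ℝ) →L[ℝ] ℝ :=
  c • ContinuousLinearMap.proj (R := ℝ) (φ := fun _ : Fin d => ℝ) S.i₀ -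
    ContinuousLinearMap.proj (R := ℝ) (φ := fun _ : Fin d => ℝ) S.i₁

theorem covec_apply (c : ℝ) (v : Fin d → ℝ) : S.covec c v = c * v S.i₀ - v S.i₁ := by
  simp [covec]

theorem covec_e (c : ℝ) : S.covec c S.e = 0 := by
  simp [covec_apply, S.e_i₀, S.e_i₁]

/-- The row `(c, -1)` is a left eigenvector of `(t, -1; 1, 0)` when `c` is a root of its
characteristic polynomial. -/
theorem covec_act {c : ℝ} (hc : S.t * c = c ^ 2 + 1) (v : Fin d → ℝ) :
    S.covec c (intAct S.M.val v) = c * S.covec c v := by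
  rw [covec_apply, covec_apply, S.act_i₀, S.act_i₁]
  linear_combination v S.i₀ * hc

theorem trace_eq_inv : S.t * S.μ⁻¹ = S.μ⁻¹ ^ 2 + 1 := by
  have := S.trace_eq
  have := S.μ_pos
  field_simp
  linarith

theorem one_lt_μ : 1 < S.μ := S.one_lt_σ.trans S.σ_lt_μ

theorem coord_eq_covec (v : Fin d → ℝ) :
    v S.i₀ = (S.μ - S.μ⁻¹)⁻¹ * (S.covec S.μ v - S.covec S.μ⁻¹ v) := by
  have h : S.μ - S.μ⁻¹ ≠ 0 := by
    have := inv_lt_one_of_one_lt₀ S.one_lt_μ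
    linarith [S.one_lt_μ]
  rw [covec_apply, covec_apply, eq_inv_mul_iff_mul_eq₀ h]
  ring

/-- The derivative of the skew product is conjugate to a constant diagonal matrix. -/
theorem exists_frame (δ : ℝ) : ∃ C C', (S.skew δ).HasDiagonalFrame S.ν C C' := by
  -- With this constant, `dψ_p = κ sin(2πx) (covec μ - covec μ⁻¹)`, which explains the opposite
  -- signs of `κ` in the two scalar equations.
  set κ : ℝ := δ * (2 * Real.pi) * (S.μ - S.μ⁻¹)⁻¹ with hκ
  have hμ := S.μ_pos
  have hσ := S.σ_pos
  have hsin : Continuous fun p : Torus d => circleSin (p S.i₀) :=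
    continuous_circleSin.comp (continuous_apply _)
  -- the coefficient along `covec μ`, by the series over the backward orbit
  obtain ⟨a, ha, haf⟩ : ∃ a : Torus d → ℝ, Continuous a ∧ ∀ p,
      S.μ * a ((S.skew δ).toHomeomorph p) = S.σ * a p + κ * circleSin (p S.i₀) := by
    set g : Torus d → ℝ := fun p =>
      κ / S.μ * circleSin ((S.skew δ).toHomeomorph.symm p S.i₀) with hg
    have hgc : Continuous g :=
      continuous_const.mul (hsin.comp (S.skew δ).toHomeomorph.symm.continuous)
    have hρ : |S.σ / S.μ| < 1 := by
      rw [abs_of_pos (by positivity), div_lt_one hμ]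
      exact S.σ_lt_μ
    refine ⟨cohomSol (S.σ / S.μ) (S.skew δ).toHomeomorph.symm g,
      continuous_cohomSol hρ (S.skew δ).toHomeomorph.symm.continuous hgc, fun p => ?_⟩
    rw [cohomSol_eq hρ hgc, (S.skew δ).toHomeomorph.symm_apply_apply]
    simp only [hg, (S.skew δ).toHomeomorph.symm_apply_apply]
    field_simp
  -- the coefficient along `covec μ⁻¹`, by the series over the forward orbit
  obtain ⟨b, hb, hbf⟩ : ∃ b : Torus d → ℝ, Continuous b ∧ ∀ p,
      S.μ⁻¹ * b ((S.skew δ).toHomeomorph p) = S.σ * b p - κ * circleSin (p S.i₀) := by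
    set g : Torus d → ℝ := fun p => κ / S.σ * circleSin (p S.i₀) with hg
    have hgc : Continuous g := continuous_const.mul hsin
    have hρ : |(S.μ * S.σ)⁻¹| < 1 := by
      rw [abs_of_pos (by positivity)]
      exact inv_lt_one_of_one_lt₀ (one_lt_mul_of_lt_of_le S.one_lt_μ S.one_lt_σ.le)
    refine ⟨cohomSol (S.μ * S.σ)⁻¹ (S.skew δ).toHomeomorph g,
      continuous_cohomSol hρ (S.skew δ).toHomeomorph.continuous hgc, fun p => ?_⟩
    rw [cohomSol_eq hρ hgc p]
    simp only [hg]
    field_simp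
    ring
  let c : Torus d → (Fin d → ℝ) →L[ℝ] ℝ := fun p => a p • S.covec S.μ + b p • S.covec S.μ⁻¹
  have hc : Continuous c := (ha.smul continuous_const).add (hb.smul continuous_const)
  -- Hence `N p` has square zero, and `Id + N p` has inverse `Id - N p`.
  have hce : ∀ p, c p S.e = 0 := fun p => by simp [c, covec_e]
  let N : Torus d → (Fin d → ℝ) →L[ℝ] (Fin d → ℝ) := fun p => (c p).smulRight S.e
  have hN : Continuous N :=
    ((ContinuousLinearMap.smulRightL ℝ (Fin d → ℝ) (Fin d → ℝ)).flip S.e).continuous.comp hc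
  refine ⟨fun p => (ContinuousLinearMap.id ℝ _ + N p).comp S.E,
    fun p => S.E'.comp (ContinuousLinearMap.id ℝ _ - N p), S.ν_ne_zero,
    (continuous_const.add hN).clm_comp continuous_const,
    continuous_const.clm_comp (continuous_const.sub hN), fun p v => ?_, fun p v => ?_,
    fun p v => ?_⟩
  · simp [N, hce, S.left_inv]
  · simp [N, hce, S.right_inv]
  -- This is the equation `c_{f(p)} ∘ M = σ c_p + dψ_p`, evaluated at `E v`.
  · have key : c ((S.skew δ).toHomeomorph p) (intAct S.M.val (S.E v)) =
        S.σ * c p (S.E v) + δ * (2 * Real.pi) * circleSin (p S.i₀) * S.E v S.i₀ := by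
      simp only [c, add_apply, smul_apply, smul_eq_mul]
      rw [covec_act S S.trace_eq, covec_act S S.trace_eq_inv, S.coord_eq_covec (S.E v)]
      have h1 := haf p
      have h2 := hbf p
      linear_combination S.covec S.μ (S.E v) * h1 + S.covec S.μ⁻¹ (S.E v) * h2
    have h1 : (ContinuousLinearMap.id ℝ (Fin d → ℝ) + N p) (S.E v) = S.E v + c p (S.E v) • S.e := by
      simp [N]
    have h2 : (ContinuousLinearMap.id ℝ (Fin d → ℝ) + N ((S.skew δ).toHomeomorph p))
        (S.E (S.ν * v)) =
        intAct S.M.val (S.E v) +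
          c ((S.skew δ).toHomeomorph p) (intAct S.M.val (S.E v)) • S.e := by
      rw [S.act_E]
      simp [N]
    rw [ContinuousLinearMap.comp_apply, ContinuousLinearMap.comp_apply, h1, h2, key,
      tangentMap_skew, intAct_add, act_smul_e, add_assoc, ← add_smul]
    simp [S.e_i₀]

theorem isAnosov_skew (δ : ℝ) : (S.skew δ).IsAnosov := by
  obtain ⟨C, C', h⟩ := S.exists_frame δ
  exact h.isAnosov S.ν_ne_one

theorem isRegularPoint_skew (δ : ℝ) (p : Torus d) : (S.skew δ).IsRegularPoint p := by
  obtain ⟨C, C', h⟩ := S.exists_frame δ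
  exact h.isRegularPoint S.ν_inj p

/-! ### The conjugacy to the linear automorphism -/

/-- The fibre displacement of the conjugacy, the bounded solution of
`σ u = u ∘ M + ψ`. -/
def u (δ : ℝ) : Torus d → ℝ :=
  cohomSol S.σ⁻¹ (intAct S.M.val) fun p => S.σ⁻¹ * S.ψ δ p

theorem abs_inv_σ_lt_one : |S.σ⁻¹| < 1 := by
  rw [abs_of_pos (inv_pos.2 S.σ_pos)]
  exact inv_lt_one_of_one_lt₀ S.one_lt_σ

theorem continuous_u (δ : ℝ) : Continuous (S.u δ) :=
  continuous_cohomSol S.abs_inv_σ_lt_one (continuous_intAct _)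
    (continuous_const.mul (S.continuous_ψ δ))

theorem σ_mul_u (δ : ℝ) (p : Torus d) :
    S.σ * S.u δ p = S.u δ (intAct S.M.val p) + S.ψ δ p := by
  have h := cohomSol_eq (T := intAct S.M.val) (g := fun p => S.σ⁻¹ * S.ψ δ p)
    S.abs_inv_σ_lt_one (continuous_const.mul (S.continuous_ψ δ)) p
  have hσ := S.σ_pos
  unfold u
  rw [h]
  field_simp

theorem u_nonneg {δ : ℝ} (hδ : 0 ≤ δ) (p : Torus d) : 0 ≤ S.u δ p :=
  cohomSol_nonneg (inv_nonneg.2 S.σ_pos.le) (fun _ => mul_nonneg (inv_nonneg.2 S.σ_pos.le)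
    (mul_nonneg hδ (circleOneSubCos_nonneg _))) p

theorem iterate_act_add (j : ℕ) (c : ℝ) (p : Torus d) :
    ∃ c' : ℝ, (intAct S.M.val)^[j] (p + Torus.proj (c • S.e)) =
      (intAct S.M.val)^[j] p + Torus.proj (c' • S.e) := by
  induction j generalizing c p with
  | zero => exact ⟨c, rfl⟩
  | succ j ih =>
    rw [Function.iterate_succ_apply, Function.iterate_succ_apply, intAct_add, proj_act_smul_e]
    exact ih _ _

/-- The map `M` preserves the direction `e` and `ψ` ignores it, so every term of the series is
unchanged. Therefore `p - u(p) e` inverts `p + u(p) e`. -/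
theorem u_add (δ c : ℝ) (p : Torus d) : S.u δ (p + Torus.proj (c • S.e)) = S.u δ p := by
  refine tsum_congr fun j => ?_
  obtain ⟨c', h⟩ := S.iterate_act_add j c p
  simp only [h, ψ_add]

theorem u_sub (δ c : ℝ) (p : Torus d) : S.u δ (p - Torus.proj (c • S.e)) = S.u δ p := by
  rw [← S.u_add δ c (p - _), sub_add_cancel]

theorem u_zero (δ : ℝ) : S.u δ 0 = 0 := by
  have h := S.σ_mul_u δ 0
  rw [intAct_zero, ψ_zero, add_zero] at h
  have h1 : (S.σ - 1) * S.u δ 0 = 0 := by linarith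
  exact (mul_eq_zero.1 h1).resolve_left (by linarith [S.one_lt_σ])

/-- The conjugacy `p ↦ p + u(p) e`. -/
def conj (δ : ℝ) : Torus d ≃ₜ Torus d where
  toFun p := p + Torus.proj (S.u δ p • S.e)
  invFun p := p - Torus.proj (S.u δ p • S.e)
  left_inv p := by simp only [u_add, add_sub_cancel_right]
  right_inv p := by simp only [u_sub, sub_add_cancel]
  continuous_toFun := continuous_id.add
    (Torus.continuous_proj.comp ((S.continuous_u δ).smul continuous_const))
  continuous_invFun := continuous_id.sub
    (Torus.continuous_proj.comp ((S.continuous_u δ).smul continuous_const))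

/-- By invariance along `e`, `u(f(p)) = u(M p)`; the two sides then agree along `e` by `σ u = u ∘ M
+ ψ`. -/
theorem isConjugacy_conj (δ : ℝ) :
    TorusDiffeo.IsConjugacy (S.conj δ) (S.skew δ) (TorusDiffeo.linear S.M) := by
  intro p
  change (S.skew δ).toHomeomorph p + Torus.proj (S.u δ ((S.skew δ).toHomeomorph p) • S.e) =
    intAct S.M.val (p + Torus.proj (S.u δ p • S.e))
  rw [skew_apply, u_add, intAct_add, proj_act_smul_e, σ_mul_u, add_smul, Torus.proj_add]
  abel

/-- The lift of the conjugacy. -/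
def conjLift (δ : ℝ) (z : Fin d → ℝ) : Fin d → ℝ := z + S.u δ (Torus.proj z) • S.e

theorem continuous_u_proj (δ : ℝ) : Continuous fun z : Fin d → ℝ => S.u δ (Torus.proj z) :=
  (S.continuous_u δ).comp Torus.continuous_proj

theorem continuous_conjLift (δ : ℝ) : Continuous (S.conjLift δ) :=
  continuous_id.add ((S.continuous_u_proj δ).smul continuous_const)

theorem conjLift_add_intVec (δ : ℝ) (z : Fin d → ℝ) (k : Fin d → ℤ) :
    S.conjLift δ (z + intVec k) = S.conjLift δ z + intVec k := by
  simp only [conjLift, Torus.proj_add, Torus.proj_intVec, add_zero]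
  abel

theorem conjLift_skew_lift (δ : ℝ) (z : Fin d → ℝ) :
    S.conjLift δ ((S.skew δ).lift z) = intAct S.M.val (S.conjLift δ z) := by
  simp only [conjLift]
  rw [(S.skew δ).proj_lift, skew_apply, u_add, intAct_add, act_smul_e, σ_mul_u, skew_lift, add_smul]
  abel

/-- A point with bounded orbit under the hyperbolic automorphism is zero. -/
theorem eq_zero_of_bounded_orbit {x : ℤ → Fin d → ℝ} {K : ℝ} (hK : ∀ n, ‖x n‖ ≤ K)
    (hx : ∀ n, x (n + 1) = intAct S.M.val (x n)) : x 0 = 0 := by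
  have h1 : ∀ n, S.E' (x (n + 1)) = S.ν * S.E' (x n) := by
    intro n
    rw [hx]
    conv_lhs => rw [← S.right_inv (x n)]
    rw [S.act_E, S.left_inv]
  have h2 : ∀ n : ℤ, S.E' (x n) = S.ν ^ n * S.E' (x 0) := by
    intro n
    induction n using Int.induction_on with
    | zero => simp
    | succ k ih =>
      rw [h1, ih]
      funext i
      simp only [Pi.mul_apply, Pi.pow_apply]
      rw [zpow_add_one₀ (S.ν_ne_zero i)]
      ring
    | pred k ih =>
      have h3 := h1 (-(k : ℤ) - 1)
      rw [sub_add_cancel, ih] at h3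
      funext i
      have h4 := congrFun h3 i
      simp only [Pi.mul_apply, Pi.pow_apply] at h4 ⊢
      rw [zpow_sub_one₀ (S.ν_ne_zero i)]
      have := S.ν_ne_zero i
      field_simp
      linarith
  have h3 : S.E' (x 0) = 0 := by
    funext i
    rw [Pi.zero_apply]
    by_contra hne
    have hbd : ∀ n : ℤ, |S.ν i| ^ n * |S.E' (x 0) i| ≤ ‖S.E'‖ * K := by
      intro n
      have h4 := norm_le_pi_norm (S.E' (x n)) i
      rw [h2 n] at h4
      simp only [Pi.mul_apply, Pi.pow_apply, norm_mul, norm_zpow, Real.norm_eq_abs] at h4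
      rw [← h2 n] at h4
      exact h4.trans ((S.E'.le_opNorm _).trans
        (mul_le_mul_of_nonneg_left (hK n) (norm_nonneg _)))
    have hpos : 0 < |S.E' (x 0) i| := abs_pos.2 hne
    have hunb : ∀ c : ℝ, 1 < c → (∀ n : ℕ, c ^ n * |S.E' (x 0) i| ≤ ‖S.E'‖ * K) → False := by
      intro c hc h
      obtain ⟨n, hn⟩ := pow_unbounded_of_one_lt (‖S.E'‖ * K / |S.E' (x 0) i|) hc
      rw [div_lt_iff₀ hpos] at hn
      exact absurd (h n) (not_le.2 hn)
    -- A nonzero contracted coordinate blows up along the backward orbit, an expanded one along the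
    -- forward orbit.
    rcases lt_or_gt_of_ne (S.ν_ne_one i) with h | h
    · refine hunb |S.ν i|⁻¹ ((one_lt_inv₀ (abs_pos.2 (S.ν_ne_zero i))).2 h) fun n => ?_
      have := hbd (-(n : ℤ))
      rwa [zpow_neg, zpow_natCast, ← inv_pow] at this
    · exact hunb |S.ν i| h fun n => by simpa using hbd n
  rw [← S.right_inv (x 0), h3, map_zero]

/-- Any conjugacy of the skew product to a linear automorphism lifts to `P ∘ conjLift + const`
with `P` linear and invertible. -/
theorem conjugacy_rigidity (δ : ℝ) {N : GL (Fin d) ℤ} {h : Torus d ≃ₜ Torus d}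
    (hconj : TorusDiffeo.IsConjugacy h (S.skew δ) (TorusDiffeo.linear N)) :
    ∃ (H : (Fin d → ℝ) → (Fin d → ℝ)) (P Q : (Fin d → ℝ) →L[ℝ] (Fin d → ℝ)),
      Continuous H ∧ (∀ z, Torus.proj (H z) = h (Torus.proj z)) ∧ (∀ v, Q (P v) = v) ∧
      ∀ z, H z = P (S.conjLift δ z) + H 0 := by
  obtain ⟨H, P, hHc, hH, hHP, hPi⟩ := exists_continuous_lift h.continuous
  obtain ⟨G, Q, hGc, hG, hGQ, hQi⟩ := exists_continuous_lift h.symm.continuous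
  -- `P` and `Q` are inverse to each other
  have hQP : Q.comp P = ContinuousLinearMap.id ℝ _ := by
    apply clm_ext_intVec
    intro k
    -- `G ∘ H - id` is integer valued, hence constant; its values at `k` and `0` give `Q P k = k`.
    have h1 := eq_of_integer_valued (G := fun z => G (H z) - z) (by fun_prop)
      (fun z => Torus.proj_eq_iff.1 (by rw [hG, hH, h.symm_apply_apply])) (0 + intVec k) 0
    simp only [hHP] at h1
    obtain ⟨l, hl⟩ := hPi k
    rw [hl, hGQ, ← hl] at h1
    simp only [ContinuousLinearMap.comp_apply, ContinuousLinearMap.id_apply]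
    rw [sub_eq_sub_iff_add_eq_add] at h1
    simpa [add_assoc] using h1
  have hPQ : P.comp Q = ContinuousLinearMap.id ℝ _ := by
    apply clm_ext_intVec
    intro k
    have h1 := eq_of_integer_valued (G := fun z => H (G z) - z) (by fun_prop)
      (fun z => Torus.proj_eq_iff.1 (by rw [hH, hG, h.apply_symm_apply])) (0 + intVec k) 0
    simp only [hGQ] at h1
    obtain ⟨l, hl⟩ := hQi k
    rw [hl, hHP, ← hl] at h1
    simp only [ContinuousLinearMap.comp_apply, ContinuousLinearMap.id_apply]
    rw [sub_eq_sub_iff_add_eq_add] at h1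
    simpa [add_assoc] using h1
  have hQP' : ∀ v, Q (P v) = v := fun v => congrArg (fun T => T v) hQP
  have hPQ' : ∀ v, P (Q v) = v := fun v => congrArg (fun T => T v) hPQ
  have hFc : Continuous (S.skew δ).lift := (S.skew δ).contDiff_lift.continuous
  -- the lifted conjugacy equation holds up to a constant
  have hHF : ∀ z, H ((S.skew δ).lift z) - intAct N.val (H z) =
      H ((S.skew δ).lift 0) - intAct N.val (H 0) := by
    intro z
    refine eq_of_integer_valued (G := fun z => H ((S.skew δ).lift z) - intAct N.val (H z))
      ((hHc.comp hFc).sub ((continuous_intAct _).comp hHc)) (fun z => ?_) z 0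
    apply Torus.proj_eq_iff.1
    rw [hH, (S.skew δ).proj_lift, hconj, proj_intAct, hH]
    rfl
  have hF0 : (S.skew δ).lift 0 = 0 := by
    rw [skew_lift, Torus.proj_zero, ψ_zero, intAct_zero, zero_smul, add_zero]
  rw [hF0] at hHF
  -- Comparing the constant at `0` and at an integer vector shows that `P` intertwines `M` and `N`.
  have hPM : ∀ v, P (intAct S.M.val v) = intAct N.val (P v) := by
    have : P.comp (intActCLM S.M.val) = (intActCLM N.val).comp P := by
      apply clm_ext_intVec
      intro k
      have h1 := hHF (0 + intVec k)
      have h2 : (S.skew δ).lift (0 + intVec k) = 0 + intVec (intAct S.M.val k) := by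
        have := S.isLinearization_skew δ 0 k
        rwa [hF0] at this
      rw [h2, hHP, hHP, intAct_add] at h1
      simp only [ContinuousLinearMap.comp_apply, intActCLM_apply, intAct_intVec]
      have h3 : H 0 + P (intVec (intAct S.M.val k)) -
          (intAct N.val (H 0) + intAct N.val (P (intVec k))) - (H 0 - intAct N.val (H 0)) = 0 := by
        rw [h1, sub_self]
      rw [← sub_eq_zero, ← h3]
      abel
    exact fun v => congrArg (fun T => T v) this
  have hQN : ∀ v, Q (intAct N.val v) = intAct S.M.val (Q v) := by
    intro v
    rw [← hQP' (intAct S.M.val (Q v)), hPM, hPQ']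
  -- the bounded difference of the two conjugacies
  set D : (Fin d → ℝ) → (Fin d → ℝ) := fun z => Q (H z - H 0) - S.conjLift δ z with hD
  have hDF : ∀ z, D ((S.skew δ).lift z) = intAct S.M.val (D z) := by
    intro z
    have h1 : H ((S.skew δ).lift z) - H 0 = intAct N.val (H z - H 0) := by
      rw [intAct_sub, sub_eq_sub_iff_sub_eq_sub]
      exact hHF z
    simp only [hD]
    rw [h1, hQN, conjLift_skew_lift, intAct_sub]
  -- `Q P = id` makes the periods of the two terms cancel, so `D` is periodic. Since `D` carries the
  -- lift of `f` to `M`, the values of `D` along an orbit form a bounded `M`-orbit.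
  obtain ⟨K, hK⟩ : ∃ K, ∀ z, ‖D z‖ ≤ K := by
    apply exists_bound_of_periodic
    · exact (Q.continuous.comp (hHc.sub continuous_const)).sub (S.continuous_conjLift δ)
    · intro z k
      congr 1
      simp only [hD, hHP, conjLift_add_intVec]
      rw [add_sub_right_comm, map_add, hQP']
      abel
  have hD0 : ∀ z, D z = 0 := by
    intro z
    have := S.eq_zero_of_bounded_orbit (x := fun n => D (((S.skew δ).lift ^ n) z))
      (fun n => hK _) (fun n => by
        rw [← hDF, ← Equiv.Perm.mul_apply, ← zpow_one_add, add_comm])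
    simpa using this
  refine ⟨H, P, Q, hHc, hH, hQP', fun z => ?_⟩
  have h1 := hD0 z
  simp only [hD, sub_eq_zero] at h1
  rw [← h1, hPQ', sub_add_cancel]

/-! ### The conjugacy is not Lipschitz -/

/-- The cohomological equation at `μ⁻¹ s w`, a point that `M` sends to `s w`. -/
theorem proj_w_u (δ s : ℝ) :
    S.σ * S.u δ (Torus.proj ((S.μ⁻¹ * s) • S.w)) =
      S.u δ (Torus.proj (s • S.w)) + S.ψ δ (Torus.proj ((S.μ⁻¹ * s) • S.w)) := by
  rw [σ_mul_u, ← proj_intAct, intAct_smul, S.act_w, smul_smul]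
  congr 4
  have := S.μ_pos
  field_simp

/-- Along the unstable line of the base, the displacement decays at most like `σ^{-j}`. -/
theorem u_lower_bound {δ : ℝ} (hδ : 0 < δ) :
    ∃ (s a : ℝ), 0 < a ∧ ∀ j : ℕ, a * S.σ⁻¹ ^ j ≤ S.u δ (Torus.proj ((S.μ⁻¹ ^ j * s) • S.w)) := by
  have hσ := S.σ_pos
  have hψ : ∀ p, 0 ≤ S.ψ δ p := fun p => mul_nonneg hδ.le (circleOneSubCos_nonneg _)
  -- The starting point has `i₀` coordinate `1/2`, where the bump takes its maximum `2 δ`; this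
  -- forces `u > 0` there.
  refine ⟨1 / (2 * S.w S.i₀), S.u δ (Torus.proj ((1 / (2 * S.w S.i₀)) • S.w)), ?_, fun j => ?_⟩
  · have h1 := S.σ_mul_u δ (Torus.proj ((1 / (2 * S.w S.i₀)) • S.w))
    have h2 : S.ψ δ (Torus.proj ((1 / (2 * S.w S.i₀)) • S.w)) = δ * 2 := by
      rw [ψ_proj, Pi.smul_apply, smul_eq_mul]
      have : 2 * Real.pi * (1 / (2 * S.w S.i₀) * S.w S.i₀) = Real.pi := by
        have := S.w_i₀
        field_simp
      rw [this, Real.cos_pi]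
      norm_num
    have h3 := S.u_nonneg hδ.le (intAct S.M.val (Torus.proj ((1 / (2 * S.w S.i₀)) • S.w)))
    rw [h2] at h1
    have h4 : 0 < S.σ * S.u δ (Torus.proj ((1 / (2 * S.w S.i₀)) • S.w)) := by
      rw [h1]
      linarith
    exact (mul_pos_iff_of_pos_left hσ).1 h4
  · induction j with
    | zero => simp
    | succ j ih =>
      have h1 := S.proj_w_u δ (S.μ⁻¹ ^ j * (1 / (2 * S.w S.i₀)))
      rw [← mul_assoc, ← pow_succ'] at h1
      have h2 := hψ (Torus.proj ((S.μ⁻¹ ^ (j + 1) * (1 / (2 * S.w S.i₀))) • S.w))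
      refine le_of_mul_le_mul_left (le_trans (le_of_eq ?_) (ih.trans (by linarith))) hσ
      rw [pow_succ]
      field_simp

/-- The displacement is not Lipschitz at `0` along the unstable line of the base. -/
theorem u_not_lipschitz {δ : ℝ} (hδ : 0 < δ) (K : ℝ)
    (h : ∀ᶠ z in 𝓝 (0 : Fin d → ℝ), S.u δ (Torus.proj z) ≤ K * ‖z‖) : False := by
  obtain ⟨s, a, ha, hlow⟩ := S.u_lower_bound hδ
  have hσ := S.σ_pos
  have hμ := S.μ_pos
  have hlim : Tendsto (fun j : ℕ => (S.μ⁻¹ ^ j * s) • S.w) atTop (𝓝 0) := by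
    have h1 : Tendsto (fun j : ℕ => S.μ⁻¹ ^ j) atTop (𝓝 0) :=
      tendsto_pow_atTop_nhds_zero_of_lt_one (inv_nonneg.2 hμ.le)
        (inv_lt_one_of_one_lt₀ S.one_lt_μ)
    simpa using (h1.mul_const s).smul_const S.w
  -- A Lipschitz bound would give `a σ^{-j} ≤ K |s| ‖w‖ μ^{-j}`, which fails for large `j` because
  -- `σ < μ`.
  have hratio : Tendsto (fun j : ℕ => K * (|s| * ‖S.w‖) * (S.σ / S.μ) ^ j) atTop (𝓝 0) := by
    have h1 : Tendsto (fun j : ℕ => (S.σ / S.μ) ^ j) atTop (𝓝 0) :=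
      tendsto_pow_atTop_nhds_zero_of_lt_one (by positivity) ((div_lt_one hμ).2 S.σ_lt_μ)
    simpa using h1.const_mul (K * (|s| * ‖S.w‖))
  obtain ⟨j, hj1, hj2⟩ := ((hlim.eventually h).and (hratio.eventually (gt_mem_nhds ha))).exists
  have h1 := (hlow j).trans hj1
  rw [norm_smul, norm_mul, norm_pow, norm_inv, Real.norm_of_nonneg hμ.le, Real.norm_eq_abs] at h1
  have h2 : a ≤ K * (|s| * ‖S.w‖) * (S.σ / S.μ) ^ j := by
    have h3 : a = a * S.σ⁻¹ ^ j * S.σ ^ j := by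
      rw [mul_assoc, ← mul_pow, inv_mul_cancel₀ hσ.ne', one_pow, mul_one]
    rw [h3, div_eq_mul_inv, mul_pow]
    calc a * S.σ⁻¹ ^ j * S.σ ^ j ≤ K * (S.μ⁻¹ ^ j * |s| * ‖S.w‖) * S.σ ^ j := by gcongr
      _ = _ := by ring
  linarith

theorem norm_e_pos : 0 < ‖S.e‖ := norm_pos_iff.2 S.e_ne_zero

/-- By rigidity `u e = Q (H z - H 0) - z`, so a Lipschitz `h` would force a Lipschitz bound on `u`
at `0`. -/
theorem not_lipschitz_conjugacy {δ : ℝ} (hδ : 0 < δ) {N : GL (Fin d) ℤ} {h : Torus d ≃ₜ Torus d}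
    (hconj : TorusDiffeo.IsConjugacy h (S.skew δ) (TorusDiffeo.linear N)) {K : ℝ≥0}
    (hK : LipschitzWith K h) : False := by
  obtain ⟨H, P, Q, hHc, hH, hQP, hHP⟩ := S.conjugacy_rigidity δ hconj
  refine S.u_not_lipschitz hδ ((‖Q‖ * K + 1) / ‖S.e‖) ?_
  have hsmall : ∀ᶠ z in 𝓝 (0 : Fin d → ℝ), ‖H z - H 0‖ < 1 / 2 := by
    have : Tendsto (fun z => ‖H z - H 0‖) (𝓝 0) (𝓝 0) := by
      have hc : Continuous fun z => ‖H z - H 0‖ := by fun_prop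
      simpa using hc.tendsto 0
    exact this.eventually (gt_mem_nhds one_half_pos)
  filter_upwards [hsmall] with z hz
  have h1 : ‖H z - H 0‖ ≤ K * ‖z‖ := by
    rw [← Torus.norm_proj_eq hz.le, Torus.proj_sub, ← dist_eq_norm, hH, hH]
    refine (hK.dist_le_mul _ _).trans ?_
    gcongr
    rw [dist_eq_norm, ← Torus.proj_sub, sub_zero]
    exact Torus.norm_proj_le z
  have h2 : S.conjLift δ z = Q (H z - H 0) := by
    rw [hHP z, add_sub_cancel_right, hQP]
  have h3 : S.u δ (Torus.proj z) • S.e = Q (H z - H 0) - z := by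
    rw [← h2, conjLift, add_sub_cancel_left]
  have h4 : S.u δ (Torus.proj z) * ‖S.e‖ ≤ (‖Q‖ * K + 1) * ‖z‖ := by
    calc S.u δ (Torus.proj z) * ‖S.e‖ = ‖S.u δ (Torus.proj z) • S.e‖ := by
          rw [norm_smul, Real.norm_of_nonneg (S.u_nonneg hδ.le _)]
      _ ≤ ‖Q (H z - H 0)‖ + ‖z‖ := by
          rw [h3]
          exact norm_sub_le _ _
      _ ≤ ‖Q‖ * (K * ‖z‖) + ‖z‖ := by
          gcongr
          exact (Q.le_opNorm _).trans (by gcongr)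
      _ = _ := by ring
  rw [div_mul_eq_mul_div, le_div_iff₀ S.norm_e_pos]
  exact h4

/-- The inverse of `conjLift` is `g z = z - u(z) e`, and rigidity gives `H (g z) - H 0 = P z`. A
Lipschitz `h⁻¹` bounds `g z`, hence `u e = z - g z`, linearly in `‖z‖`. -/
theorem not_lipschitz_conjugacy_symm {δ : ℝ} (hδ : 0 < δ) {N : GL (Fin d) ℤ}
    {h : Torus d ≃ₜ Torus d}
    (hconj : TorusDiffeo.IsConjugacy h (S.skew δ) (TorusDiffeo.linear N)) {K : ℝ≥0}
    (hK : LipschitzWith K h.symm) : False := by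
  obtain ⟨H, P, Q, hHc, hH, hQP, hHP⟩ := S.conjugacy_rigidity δ hconj
  refine S.u_not_lipschitz hδ ((K * ‖P‖ + 1) / ‖S.e‖) ?_
  set g : (Fin d → ℝ) → (Fin d → ℝ) := fun z => z - S.u δ (Torus.proj z) • S.e with hg
  have hgc : Continuous g := continuous_id.sub ((S.continuous_u_proj δ).smul continuous_const)
  have hg0 : g 0 = 0 := by simp [hg, Torus.proj_zero, u_zero]
  have hsmall : ∀ᶠ z in 𝓝 (0 : Fin d → ℝ), ‖g z‖ < 1 / 2 := by
    have : Tendsto (fun z => ‖g z‖) (𝓝 0) (𝓝 0) := by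
      simpa [hg0] using hgc.norm.tendsto 0
    exact this.eventually (gt_mem_nhds one_half_pos)
  filter_upwards [hsmall] with z hz
  have hconjg : S.conjLift δ (g z) = z := by
    simp only [conjLift, hg, Torus.proj_sub, u_sub, sub_add_cancel]
  have h1 : ‖g z‖ ≤ K * (‖P‖ * ‖z‖) := by
    have e1 : Torus.proj (g z) - Torus.proj 0 =
        h.symm (Torus.proj (H (g z))) - h.symm (Torus.proj (H 0)) := by
      rw [hH, hH, h.symm_apply_apply, h.symm_apply_apply]
    rw [← Torus.norm_proj_eq hz.le, ← sub_zero (Torus.proj (g z)), ← Torus.proj_zero, e1,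
      ← dist_eq_norm]
    refine (hK.dist_le_mul _ _).trans ?_
    gcongr
    rw [dist_eq_norm, ← Torus.proj_sub]
    refine (Torus.norm_proj_le _).trans ?_
    rw [hHP (g z), add_sub_cancel_right, hconjg]
    exact P.le_opNorm z
  have h3 : S.u δ (Torus.proj z) • S.e = z - g z := by
    simp only [hg, sub_sub_cancel]
  have h4 : S.u δ (Torus.proj z) * ‖S.e‖ ≤ (K * ‖P‖ + 1) * ‖z‖ := by
    calc S.u δ (Torus.proj z) * ‖S.e‖ = ‖S.u δ (Torus.proj z) • S.e‖ := by
          rw [norm_smul, Real.norm_of_nonneg (S.u_nonneg hδ.le _)]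
      _ ≤ ‖z‖ + ‖g z‖ := by
          rw [h3]
          exact norm_sub_le _ _
      _ ≤ ‖z‖ + K * (‖P‖ * ‖z‖) := by gcongr
      _ = _ := by ring
  rw [div_mul_eq_mul_div, le_div_iff₀ S.norm_e_pos]
  exact h4

end SkewModel

/-! ### Integer matrices with simple real hyperbolic spectrum -/

/-- The endomorphism of `𝕜^d` given by an integer matrix. -/
def intActEnd {d : ℕ} (𝕜 : Type*) [Field 𝕜] (M : Matrix (Fin d) (Fin d) ℤ) :
    Module.End 𝕜 (Fin d → 𝕜) where
  toFun := intAct M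
  map_add' := intAct_add M
  map_smul' := intAct_smul M

theorem linearIndependent_of_eigen {d : ℕ} {𝕜 ι : Type*} [Field 𝕜]
    {M : Matrix (Fin d) (Fin d) ℤ} {ν : ι → 𝕜} (hν : Function.Injective ν) {v : ι → Fin d → 𝕜}
    (hv0 : ∀ i, v i ≠ 0) (hv : ∀ i, intAct M (v i) = ν i • v i) : LinearIndependent 𝕜 v :=
  Module.End.eigenvectors_linearIndependent' (intActEnd 𝕜 M) ν hν v fun i =>
    ⟨Module.End.mem_eigenspace_iff.2 (hv i), hv0 i⟩

/-- Another complex eigenvalue would produce `d + 1` independent vectors in `ℂ^d`. -/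
theorem isHyperbolicMatrix_of_eigen {d : ℕ} {M : GL (Fin d) ℤ} {ν : Fin d → ℝ}
    (hν : Function.Injective ν) (h1 : ∀ i, |ν i| ≠ 1)
    (hv : ∀ i, ∃ v : Fin d → ℝ, v ≠ 0 ∧ intAct M.val v = ν i • v) : IsHyperbolicMatrix M := by
  intro z x hx hz
  choose v hv0 hv using hv
  by_cases h : ∃ i, z = ν i
  · obtain ⟨i, rfl⟩ := h
    simpa using h1 i
  · exfalso
    have hli : LinearIndependent ℂ
        (fun o : Option (Fin d) => o.elim x fun i j => (v i j : ℂ)) := by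
      refine linearIndependent_of_eigen (M := M.val) (ν := fun o => o.elim z fun i => (ν i : ℂ))
        ?_ ?_ ?_
      · rintro (_ | i) (_ | j) hij
        · rfl
        · exact absurd ⟨j, hij⟩ h
        · exact absurd ⟨i, hij.symm⟩ h
        · have : ν i = ν j := Complex.ofReal_injective hij
          rw [hν this]
      · rintro (_ | i)
        · exact hx
        · intro h0
          apply hv0 i
          funext j
          exact Complex.ofReal_injective (congrFun h0 j)
      · rintro (_ | i)
        · exact hz
        · funext j
          have h2 := congrFun (hv i) j
          simp only [intAct, Pi.smul_apply, zsmul_eq_mul, smul_eq_mul, Option.elim_some] at h2 ⊢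
          exact_mod_cast congrArg (fun y : ℝ => (y : ℂ)) h2
    have := hli.fintype_card_le_finrank
    simp at this

/-- Diagonalization of an integer matrix with simple real spectrum. -/
theorem exists_diagonalization {d : ℕ} {M : Matrix (Fin d) (Fin d) ℤ} {ν : Fin d → ℝ}
    (hν : Function.Injective ν)
    (hv : ∀ i, ∃ v : Fin d → ℝ, v ≠ 0 ∧ intAct M v = ν i • v) :
    ∃ E E' : (Fin d → ℝ) →L[ℝ] (Fin d → ℝ), (∀ x, E' (E x) = x) ∧ (∀ x, E (E' x) = x) ∧
      ∀ x, intAct M (E x) = E (ν * x) := by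
  choose v hv0 hv using hv
  have hli := linearIndependent_of_eigen hν hv0 hv
  let b : Module.Basis (Fin d) ℝ (Fin d → ℝ) :=
    basisOfLinearIndependentOfCardEqFinrank' v hli (by simp)
  have hb : ∀ i, b i = v i := fun i => by simp [b]
  let T := b.equivFun.toContinuousLinearEquiv
  refine ⟨T.symm, T, fun x => T.apply_symm_apply x, fun x => T.symm_apply_apply x, fun x => ?_⟩
  have hT : ∀ x, T.symm x = ∑ i, x i • v i := fun x => by
    have := b.equivFun_symm_apply x
    simp only [hb] at this
    exact this
  change intActCLM M (T.symm x) = T.symm (ν * x)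
  rw [hT, hT, map_sum]
  refine Finset.sum_congr rfl fun i _ => ?_
  rw [map_smul, intActCLM_apply, hv, smul_smul, Pi.mul_apply, mul_comm]

/-! #### Arbitrary dimension -/

section Newton

variable {k : ℕ}

/-- The cyclic successor on `Fin k`. -/
def cycSucc (i : Fin k) : Fin k :=
  if h : i.val + 1 < k then ⟨i.val + 1, h⟩ else ⟨0, i.pos⟩

/-- The matrix of the multiplication by `x` modulo `∏_{i<k} (x - 4 i) + 1`, in the basis of the
Newton polynomials `∏_{i<j} (x - 4 i)`. -/
def newtonMatrix (k : ℕ) : Matrix (Fin k) (Fin k) ℤ := fun i j =>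
  (if i = j then 4 * (i.val : ℤ) else 0) +
    if cycSucc i = j then (if i.val + 1 < k then 1 else -1) else 0

theorem intAct_newtonMatrix {V : Type*} [AddCommGroup V] (v : Fin k → V) (i : Fin k) :
    intAct (newtonMatrix k) v i = (4 * (i.val : ℤ)) • v i +
      (if i.val + 1 < k then (1 : ℤ) else -1) • v (cycSucc i) := by
  simp only [intAct, newtonMatrix, add_smul, Finset.sum_add_distrib, ite_smul, zero_smul,
    Finset.sum_ite_eq, Finset.mem_univ, if_true]

/-- The system `B v = w` is solved over `ℤ` row by row: each row but the last determines the next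
coordinate, and the last one returns `v 0` with coefficient `-1`. -/
theorem isUnit_newtonMatrix (hk : 2 ≤ k) : IsUnit (newtonMatrix k) := by
  rw [← Matrix.mulVec_surjective_iff_isUnit]
  intro w
  let x : ℕ → ℤ := fun n => Nat.rec 0
    (fun n y => (if h : n < k then w ⟨n, h⟩ else 0) - 4 * n * y) n
  have hx : ∀ n (h : n < k), x (n + 1) = w ⟨n, h⟩ - 4 * n * x n := by
    intro n h
    simp only [x, dif_pos h]
  let v : Fin k → ℤ := fun j =>
    if j.val = 0 then 4 * ((k - 1 : ℕ) : ℤ) * x (k - 1) - w ⟨k - 1, by omega⟩ else x j.val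
  refine ⟨v, ?_⟩
  have hact : (newtonMatrix k).mulVec v = intAct (newtonMatrix k) v := by
    funext i
    simp [Matrix.mulVec, dotProduct, intAct]
  rw [hact]
  funext i
  rw [intAct_newtonMatrix]
  have hdiag : 4 * (i.val : ℤ) * v i = 4 * (i.val : ℤ) * x i.val := by
    by_cases hi : i.val = 0
    · simp [hi]
    · simp [v, hi]
  rw [smul_eq_mul, hdiag]
  by_cases hi : i.val + 1 < k
  · have h1 : v (cycSucc i) = x (i.val + 1) := by
      simp [v, cycSucc, hi]
    rw [if_pos hi, h1, hx _ i.isLt]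
    simp
  · have hik : i.val = k - 1 := by omega
    have h1 : v (cycSucc i) = 4 * ((k - 1 : ℕ) : ℤ) * x (k - 1) - w ⟨k - 1, by omega⟩ := by
      simp [v, cycSucc, hi]
    have h2 : w i = w ⟨k - 1, by omega⟩ := congrArg w (Fin.ext hik)
    rw [if_neg hi, h1, hik, h2, smul_eq_mul]
    ring

/-- The Newton polynomials satisfy `x N_j = 4 j N_j + N_{j+1}`; in the last row `N_k(r) = -1` closes
the cycle. -/
theorem newtonMatrix_eigen {r : ℝ} (hr : ∏ i ∈ Finset.range k, (r - 4 * i) = -1) :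
    intAct (newtonMatrix k) (fun j : Fin k => ∏ i ∈ Finset.range j.val, (r - 4 * i)) =
      r • fun j : Fin k => ∏ i ∈ Finset.range j.val, (r - 4 * i) := by
  funext i
  rw [intAct_newtonMatrix]
  by_cases hi : i.val + 1 < k
  · simp only [cycSucc, hi, dif_pos, if_true, Pi.smul_apply, smul_eq_mul, zsmul_eq_mul,
      Finset.prod_range_succ]
    push_cast
    ring
  · have hik : k = i.val + 1 := by omega
    have h1 : (∏ j ∈ Finset.range i.val, (r - 4 * j)) * (r - 4 * i.val) = -1 := by
      rw [← Finset.prod_range_succ, ← hik]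
      exact hr
    simp only [cycSucc, hi, dif_neg, not_false_iff, if_false, Pi.smul_apply, smul_eq_mul,
      zsmul_eq_mul, Finset.range_zero, Finset.prod_empty]
    push_cast
    linarith

/-- Within distance `1` of `4 j` the other factors have modulus at least `1` and fixed signs, so the
product is at most `-1` at one of `4 j ± 1`. It vanishes at `4 j`, and the intermediate value
theorem applies. -/
theorem exists_newton_root {j : ℕ} (hj : j < k) :
    ∃ r : ℝ, 4 * j - 1 ≤ r ∧ r ≤ 4 * j + 1 ∧ ∏ i ∈ Finset.range k, (r - 4 * i) = -1 := by
  set q : ℝ → ℝ := fun x => ∏ i ∈ Finset.range k, (x - 4 * i) with hq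
  have hqc : Continuous q := continuous_finsetProd _ fun i _ => by fun_prop
  -- Only the sign of `s` matters: it is the common sign of `R` near `4 j`, and decides on which
  -- side the root is found.
  set s : ℝ := ∏ i ∈ (Finset.range k).erase j, ((j : ℝ) - i) with hs
  set R : ℝ → ℝ := fun x => ∏ i ∈ (Finset.range k).erase j, (x - 4 * i) with hR
  have hqR : ∀ x, q x = (x - 4 * j) * R x := fun x =>
    (Finset.mul_prod_erase _ _ (Finset.mem_range.2 hj)).symm
  have hfac : ∀ (x : ℝ) (i : ℕ), |x - 4 * j| ≤ 1 → i ≠ j →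
      0 < ((j : ℝ) - i) * (x - 4 * i) ∧ 1 ≤ |x - 4 * i| := by
    intro x i hx hij
    obtain ⟨hx1, hx2⟩ := abs_le.1 hx
    rcases lt_or_gt_of_ne hij with h | h
    · have : (i : ℝ) + 1 ≤ j := by exact_mod_cast h
      refine ⟨mul_pos (by linarith) (by linarith), ?_⟩
      rw [abs_of_pos (by linarith)]
      linarith
    · have : (j : ℝ) + 1 ≤ i := by exact_mod_cast h
      refine ⟨mul_pos_of_neg_of_neg (by linarith) (by linarith), ?_⟩
      rw [abs_of_neg (by linarith)]
      linarith
  have hsR : ∀ x : ℝ, |x - 4 * j| ≤ 1 → 0 < s * R x := by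
    intro x hx
    rw [hs, hR, ← Finset.prod_mul_distrib]
    exact Finset.prod_pos fun i hi => (hfac x i hx (Finset.mem_erase.1 hi).1).1
  have hR1 : ∀ x : ℝ, |x - 4 * j| ≤ 1 → 1 ≤ |R x| := by
    intro x hx
    rw [hR, Finset.abs_prod]
    exact Finset.one_le_prod fun i hi => (hfac x i hx (Finset.mem_erase.1 hi).1).2
  have hq0 : q (4 * j) = 0 := by rw [hqR]; simp
  have hs0 : s ≠ 0 := by
    intro h
    have := hsR (4 * j) (by simp)
    rw [h, zero_mul] at this
    exact lt_irrefl _ this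
  rcases lt_or_gt_of_ne hs0 with h | h
  · have hx : |(4 * j + 1 : ℝ) - 4 * j| ≤ 1 := by simp
    have h1 : R (4 * j + 1) < 0 := neg_of_mul_pos_right (hsR _ hx) h.le
    have h2 := hR1 _ hx
    rw [abs_of_neg h1] at h2
    have h3 : q (4 * j + 1) ≤ -1 := by
      rw [hqR]
      linarith
    obtain ⟨r, hr, hr'⟩ := intermediate_value_Icc' (by linarith : (4 * j : ℝ) ≤ 4 * j + 1)
      hqc.continuousOn ⟨h3, by rw [hq0]; norm_num⟩
    exact ⟨r, by linarith [hr.1], hr.2, hr'⟩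
  · have hx : |(4 * j - 1 : ℝ) - 4 * j| ≤ 1 := by simp
    have h1 : 0 < R (4 * j - 1) := (pos_iff_pos_of_mul_pos (hsR _ hx)).1 h
    have h2 := hR1 _ hx
    rw [abs_of_pos h1] at h2
    have h3 : q (4 * j - 1) ≤ -1 := by
      rw [hqR]
      linarith
    obtain ⟨r, hr, hr'⟩ := intermediate_value_Icc (by linarith : (4 * j - 1 : ℝ) ≤ 4 * j)
      hqc.continuousOn ⟨h3, by rw [hq0]; norm_num⟩
    exact ⟨r, hr.1, by linarith [hr.2], hr'⟩

theorem newton_root_ne_zero (hk : 2 ≤ k) {r : ℝ}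
    (hr : ∏ i ∈ Finset.range k, (r - 4 * i) = -1) : r ≠ 0 := by
  rintro rfl
  rw [Finset.prod_eq_zero (i := 0) (Finset.mem_range.2 (by omega)) (by simp)] at hr
  norm_num at hr

/-- At an integer root `n` the factor `n - 4` divides `-1`, which excludes `n = 1` and `n = -1`. -/
theorem abs_newton_root_ne_one (hk : 2 ≤ k) {r : ℝ}
    (hr : ∏ i ∈ Finset.range k, (r - 4 * i) = -1) : |r| ≠ 1 := by
  have key : ∀ n : ℤ, r = n → n - 4 ∣ -1 := by
    rintro n rfl
    have h1 : ∏ i ∈ Finset.range k, (n - 4 * (i : ℤ)) = -1 := by exact_mod_cast hr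
    rw [← h1]
    simpa using Finset.dvd_prod_of_mem (fun i : ℕ => n - 4 * (i : ℤ))
      (Finset.mem_range.2 (by omega : 1 < k))
  intro h
  rcases (abs_eq zero_le_one).1 h with h | h
  · have := key 1 (by simpa using h)
    norm_num at this
  · have := key (-1) (by simpa using h)
    norm_num at this

theorem exists_hyperbolic_matrix (hk : 2 ≤ k) :
    ∃ (B : GL (Fin k) ℤ) (r : Fin k → ℝ), Function.Injective (fun i => |r i|) ∧
      (∀ i, r i ≠ 0) ∧ (∀ i, |r i| ≠ 1) ∧ (∃ i, 1 < r i) ∧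
      ∀ i, ∃ v : Fin k → ℝ, v ≠ 0 ∧ intAct B.val v = r i • v := by
  obtain ⟨B, hB⟩ := isUnit_newtonMatrix hk
  choose r hr1 hr2 hr using fun j : Fin k => exists_newton_root j.isLt
  -- The intervals `[4 j - 1, 4 j + 1]` are disjoint, and all but the first lie to the right of `3`.
  have hlt : ∀ i j : Fin k, i < j → |r i| < |r j| := by
    intro i j hij
    have h1 : ((i.val : ℕ) : ℝ) + 1 ≤ (j.val : ℕ) := by exact_mod_cast hij
    have h0 : (0 : ℝ) ≤ (i.val : ℕ) := Nat.cast_nonneg _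
    refine lt_of_lt_of_le (b := r j) (abs_lt.2 ⟨?_, ?_⟩) (le_abs_self _)
    · linarith [hr1 i, hr1 j]
    · linarith [hr2 i, hr1 j]
  refine ⟨B, r, ?_, fun i => newton_root_ne_zero hk (hr i),
    fun i => abs_newton_root_ne_one hk (hr i), ⟨⟨1, by omega⟩, ?_⟩, fun i => ?_⟩
  · exact (StrictMono.injective fun i j hij => hlt i j hij)
  · have := hr1 ⟨1, by omega⟩
    norm_num at this
    linarith
  · refine ⟨_, ?_, hB ▸ newtonMatrix_eigen (hr i)⟩
    intro h
    have := congrFun h ⟨0, by omega⟩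
    simp at this

end Newton

/-! #### Dimension two -/

/-- The matrix `(t, -1; 1, 0)`. -/
def traceMatrix (t : ℤ) : GL (Fin 2) ℤ where
  val := !![t, -1; 1, 0]
  inv := !![0, 1; -1, t]
  val_inv := by
    ext i j
    fin_cases i <;> fin_cases j <;> simp
  inv_val := by
    ext i j
    fin_cases i <;> fin_cases j <;> simp

theorem traceMatrix_act_zero {t : ℤ} (x : Fin 2 → ℝ) :
    intAct (traceMatrix t).val x 0 = t * x 0 - x 1 := by
  simp [intAct, traceMatrix, sub_eq_add_neg]

theorem traceMatrix_act_one {t : ℤ} (x : Fin 2 → ℝ) :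
    intAct (traceMatrix t).val x 1 = x 0 := by
  simp [intAct, traceMatrix]

theorem traceMatrix_eigen {t : ℤ} {c : ℝ} (hc : t * c = c ^ 2 + 1) :
    intAct (traceMatrix t).val ![c, 1] = c • ![c, 1] := by
  funext i
  fin_cases i
  · refine (traceMatrix_act_zero _).trans ?_
    simp
    linarith
  · refine (traceMatrix_act_one _).trans ?_
    simp

/-- The larger root of `x² - t x + 1` is at least `t / 2`, so a large trace suffices. -/
theorem exists_large_trace (R : ℝ) : ∃ (t : ℤ) (μ : ℝ), R < μ ∧ 1 < μ ∧ t * μ = μ ^ 2 + 1 := by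
  obtain ⟨t, ht⟩ := exists_int_gt (2 * |R| + 3)
  have hR := abs_nonneg R
  have hR' := le_abs_self R
  have h4 : (0 : ℝ) ≤ (t : ℝ) ^ 2 - 4 := by nlinarith
  have hs := Real.sq_sqrt h4
  have hs0 := Real.sqrt_nonneg ((t : ℝ) ^ 2 - 4)
  refine ⟨t, (t + Real.sqrt ((t : ℝ) ^ 2 - 4)) / 2, by linarith, by linarith, ?_⟩
  nlinarith

/-! ### Product automorphisms -/

section Pair

variable {d : ℕ}

/-- The splitting of the coordinates of `V^d` into those of `V^2` and of `V^(d-2)`. -/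
def pairEquiv (hd : 2 ≤ d) : Fin 2 ⊕ Fin (d - 2) ≃ Fin d :=
  finSumFinEquiv.trans (finCongr (by omega))

theorem pairCoord_pairEquiv {V : Type*} (hd : 2 ≤ d) (x : Fin 2 → V) (y : Fin (d - 2) → V)
    (s : Fin 2 ⊕ Fin (d - 2)) : pairCoord x y (pairEquiv hd s) = Sum.elim x y s := by
  rcases s with i | j
  · simp [pairCoord, pairEquiv, i.isLt]
  · simp [pairCoord, pairEquiv]
    omega

theorem pairCoord_surjective {V : Type*} (hd : 2 ≤ d) (z : Fin d → V) :
    z = pairCoord (fun i => z (pairEquiv hd (Sum.inl i))) fun j => z (pairEquiv hd (Sum.inr j)) := by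
  funext i
  obtain ⟨s, rfl⟩ := (pairEquiv hd).surjective i
  rw [pairCoord_pairEquiv]
  rcases s with i | j <;> rfl

theorem pairCoord_add {V : Type*} [Add V] (x x' : Fin 2 → V) (y y' : Fin (d - 2) → V) :
    pairCoord x y + pairCoord x' y' = pairCoord (x + x') (y + y') := by
  funext i
  simp only [pairCoord, Pi.add_apply]
  split_ifs <;> rfl

theorem smul_pairCoord (c : ℝ) (x : Fin 2 → ℝ) (y : Fin (d - 2) → ℝ) :
    c • pairCoord x y = pairCoord (c • x) (c • y) := by
  funext i
  simp only [pairCoord, Pi.smul_apply]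
  split_ifs <;> rfl

theorem proj_pairCoord (x : Fin 2 → ℝ) (y : Fin (d - 2) → ℝ) :
    Torus.proj (pairCoord x y : Fin d → ℝ) = pairCoord (Torus.proj x) (Torus.proj y) := by
  funext i
  simp only [pairCoord, Torus.proj]
  split_ifs <;> rfl

/-- The block diagonal matrix with blocks `A` and `B`. -/
def pairMatrix (hd : 2 ≤ d) (A : Matrix (Fin 2) (Fin 2) ℤ)
    (B : Matrix (Fin (d - 2)) (Fin (d - 2)) ℤ) : Matrix (Fin d) (Fin d) ℤ :=
  (Matrix.fromBlocks A 0 0 B).submatrix (pairEquiv hd).symm (pairEquiv hd).symm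

theorem pairMatrix_mul (hd : 2 ≤ d) (A A' : Matrix (Fin 2) (Fin 2) ℤ)
    (B B' : Matrix (Fin (d - 2)) (Fin (d - 2)) ℤ) :
    pairMatrix hd A B * pairMatrix hd A' B' = pairMatrix hd (A * A') (B * B') := by
  rw [pairMatrix, pairMatrix, Matrix.submatrix_mul_equiv, Matrix.fromBlocks_multiply]
  simp [pairMatrix]

theorem pairMatrix_one (hd : 2 ≤ d) : pairMatrix hd 1 1 = (1 : Matrix (Fin d) (Fin d) ℤ) := by
  rw [pairMatrix, Matrix.fromBlocks_one, Matrix.submatrix_one_equiv]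

theorem intAct_pairMatrix {V : Type*} [AddCommGroup V] (hd : 2 ≤ d)
    (A : Matrix (Fin 2) (Fin 2) ℤ) (B : Matrix (Fin (d - 2)) (Fin (d - 2)) ℤ)
    (x : Fin 2 → V) (y : Fin (d - 2) → V) :
    intAct (pairMatrix hd A B) (pairCoord x y) = pairCoord (intAct A x) (intAct B y) := by
  funext i
  obtain ⟨s, rfl⟩ := (pairEquiv hd).surjective i
  rw [pairCoord_pairEquiv]
  simp only [intAct]
  rw [← Equiv.sum_comp (pairEquiv hd), Fintype.sum_sum_type]
  simp only [pairCoord_pairEquiv, pairMatrix, Matrix.submatrix_apply, Equiv.symm_apply_apply]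
  rcases s with i | j <;> simp [intAct]

/-- The product of two automorphisms. -/
def pairGL (hd : 2 ≤ d) (A : GL (Fin 2) ℤ) (B : GL (Fin (d - 2)) ℤ) : GL (Fin d) ℤ where
  val := pairMatrix hd A.val B.val
  inv := pairMatrix hd A.inv B.inv
  val_inv := by rw [pairMatrix_mul, A.val_inv, B.val_inv, pairMatrix_one]
  inv_val := by rw [pairMatrix_mul, A.inv_val, B.inv_val, pairMatrix_one]

theorem intAct_pairGL {V : Type*} [AddCommGroup V] (hd : 2 ≤ d) (A : GL (Fin 2) ℤ)
    (B : GL (Fin (d - 2)) ℤ) (x : Fin 2 → V) (y : Fin (d - 2) → V) :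
    intAct (pairGL hd A B).val (pairCoord x y) = pairCoord (intAct A.val x) (intAct B.val y) :=
  intAct_pairMatrix hd _ _ x y

theorem pairCoord_ne_zero_left (hd : 2 ≤ d) {x : Fin 2 → ℝ} (hx : x ≠ 0) :
    (pairCoord x 0 : Fin d → ℝ) ≠ 0 := by
  intro h
  apply hx
  funext i
  have := congrFun h (pairEquiv hd (Sum.inl i))
  rwa [pairCoord_pairEquiv] at this

theorem pairCoord_ne_zero_right (hd : 2 ≤ d) {y : Fin (d - 2) → ℝ} (hy : y ≠ 0) :
    (pairCoord 0 y : Fin d → ℝ) ≠ 0 := by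
  intro h
  apply hy
  funext j
  have := congrFun h (pairEquiv hd (Sum.inr j))
  rwa [pairCoord_pairEquiv] at this

theorem pairGL_eigen_left (hd : 2 ≤ d) {A : GL (Fin 2) ℤ} (B : GL (Fin (d - 2)) ℤ)
    {x : Fin 2 → ℝ} {c : ℝ} (h : intAct A.val x = c • x) :
    intAct (pairGL hd A B).val (pairCoord x 0) = c • pairCoord x 0 := by
  rw [intAct_pairGL, h, intAct_zero, smul_pairCoord, smul_zero]

theorem pairGL_eigen_right (hd : 2 ≤ d) (A : GL (Fin 2) ℤ) {B : GL (Fin (d - 2)) ℤ}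
    {y : Fin (d - 2) → ℝ} {c : ℝ} (h : intAct B.val y = c • y) :
    intAct (pairGL hd A B).val (pairCoord 0 y) = c • pairCoord 0 y := by
  rw [intAct_pairGL, h, intAct_zero, smul_pairCoord, smul_zero]

end Pair

/-! ### The example in dimension `d` -/

theorem intAct_pow_three {k : ℕ} {B : GL (Fin k) ℤ} {y : Fin k → ℝ} {c : ℝ}
    (h : intAct B.val y = c • y) : intAct (B ^ 3).val y = c ^ 3 • y := by
  have : (B ^ 3).val = B.val * (B.val * B.val) := by
    rw [Units.val_pow_eq_pow_val, pow_succ', pow_two]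
  rw [this, intAct_mul, intAct_mul, h, intAct_smul, h, intAct_smul, intAct_smul, h, smul_smul,
    smul_smul]
  congr 1
  ring

theorem injective_of_abs {ι : Type*} {ν : ι → ℝ} (h : Function.Injective fun i => |ν i|) :
    Function.Injective ν :=
  fun _ _ hij => h (congrArg abs hij)

end

theorem mainTheorem2 (d : ℕ) (hd : 4 ≤ d) :
    ∃ (A : GL (Fin 2) ℤ) (B : GL (Fin (d - 2)) ℤ) (n m : ℕ) (lam : ℝ) (e : Fin (d - 2) → ℝ)
      (M : GL (Fin d) ℤ),
      -- `A`, `B` are linear Anosov automorphisms with simple real spectrum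
      IsHyperbolicMatrix A ∧ HasSimpleRealSpectrum A ∧
      IsHyperbolicMatrix B ∧ HasSimpleRealSpectrum B ∧
      1 ≤ n ∧ n < m ∧
      -- `e` is an unstable eigenvector of `B`
      e ≠ 0 ∧ intAct B.val e = lam • e ∧ 1 < |lam| ∧
      -- the linear automorphism `L = A^n × B^m`
      (∀ (x : Torus 2) (y : Torus (d - 2)),
        (TorusDiffeo.linear M).toHomeomorph (pairCoord x y) =
          pairCoord (intAct (A ^ n).val x) (intAct (B ^ m).val y)) ∧
      IsHyperbolicMatrix M ∧ HasSimpleRealSpectrum M ∧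
      ∀ U : Set (TorusDiffeo d), TorusDiffeo.IsCInftyNhd U (TorusDiffeo.linear M) →
        ∃ f ∈ U,
          -- `f(x, y) = (A^n x, B^m y + ψ(x) e)`
          (∃ ψ : Torus 2 → ℝ, ContDiff ℝ ∞ (fun x : Fin 2 → ℝ => ψ (Torus.proj x)) ∧
            ∀ (x : Torus 2) (y : Torus (d - 2)),
              f.toHomeomorph (pairCoord x y) =
                pairCoord (intAct (A ^ n).val x)
                  (intAct (B ^ m).val y + Torus.proj (ψ x • e))) ∧
          f.IsAnosov ∧
          (∀ p : Torus d, f.IsRegularPoint p) ∧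
          f.IsLinearization M ∧
          (∃ h : Torus d ≃ₜ Torus d, TorusDiffeo.IsConjugacy h f (TorusDiffeo.linear M)) ∧
          -- `f` is not Lipschitz conjugate to its linearization, nor to any linear automorphism
          ∀ (N : GL (Fin d) ℤ) (h : Torus d ≃ₜ Torus d),
            TorusDiffeo.IsConjugacy h f (TorusDiffeo.linear N) →
              (¬ ∃ K : ℝ≥0, LipschitzWith K h) ∧ ¬ ∃ K : ℝ≥0, LipschitzWith K h.symm := by
  have hd2 : 2 ≤ d := by omega
  obtain ⟨B, r, hrinj, hr0, hr1, ⟨j₀, hj₀⟩, hrv⟩ := exists_hyperbolic_matrix (k := d - 2) (by omega)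
  choose v hv0 hv using hrv
  -- `A` is chosen after `B`: the sum dominates every `|r j|^3` and its inverse, so the moduli of
  -- the spectrum of `B^3` lie strictly between `μ⁻¹` and `μ`. This gives both `σ < μ` and distinct
  -- moduli for the product.
  obtain ⟨t, μ, hμR, hμ1, htμ⟩ := exists_large_trace (∑ j, (|r j| ^ 3 + (|r j| ^ 3)⁻¹))
  have hμ0 : 0 < μ := one_pos.trans hμ1
  have habs : ∀ j, 0 < |r j| ^ 3 := fun j => pow_pos (abs_pos.2 (hr0 j)) 3
  have hbound : ∀ j, |r j| ^ 3 + (|r j| ^ 3)⁻¹ < μ := fun j =>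
    lt_of_le_of_lt (Finset.single_le_sum (f := fun j => |r j| ^ 3 + (|r j| ^ 3)⁻¹)
      (fun i _ => (add_pos (habs i) (inv_pos.2 (habs i))).le) (Finset.mem_univ j)) hμR
  have hupper : ∀ j, |r j| ^ 3 < μ := fun j => by
    linarith [hbound j, inv_pos.2 (habs j)]
  have hlower : ∀ j, μ⁻¹ < |r j| ^ 3 := fun j =>
    inv_lt_of_inv_lt₀ (habs j) (by linarith [hbound j, habs j])
  have hμi1 : μ⁻¹ < 1 := inv_lt_one_of_one_lt₀ hμ1
  have hμi0 : 0 < μ⁻¹ := inv_pos.2 hμ0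
  have htμ' : t * μ⁻¹ = μ⁻¹ ^ 2 + 1 := by
    field_simp
    linarith
  set α : Fin 2 → ℝ := ![μ, μ⁻¹] with hα
  have hα0 : ∀ i, 0 < α i := by
    intro i
    fin_cases i
    · exact hμ0
    · exact hμi0
  have hα1 : ∀ i, |α i| ≠ 1 := by
    intro i
    rw [abs_of_pos (hα0 i)]
    fin_cases i
    · exact hμ1.ne'
    · exact hμi1.ne
  have hαinj : Function.Injective fun i => |α i| := by
    intro i j hij
    simp only [abs_of_pos (hα0 _)] at hij
    fin_cases i <;> fin_cases j
    · rfl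
    · exact absurd hij (hμi1.trans hμ1).ne'
    · exact absurd hij (hμi1.trans hμ1).ne
    · rfl
  have hαv : ∀ i, ∃ x : Fin 2 → ℝ, x ≠ 0 ∧ intAct (traceMatrix t).val x = α i • x := by
    intro i
    refine ⟨![α i, 1], fun h => ?_, traceMatrix_eigen ?_⟩
    · have := congrFun h 1
      simp at this
    · fin_cases i
      · exact htμ
      · exact htμ'
  have hαr : ∀ i j, |α i| ≠ |r j ^ 3| := by
    intro i j
    rw [abs_of_pos (hα0 i), abs_pow]
    fin_cases i
    · exact (hupper j).ne'
    · exact (hlower j).ne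
  -- the spectrum of the product
  set M := pairGL hd2 (traceMatrix t) (B ^ 3) with hM
  set ν : Fin d → ℝ := pairCoord α fun j => r j ^ 3 with hν
  have hνinj : Function.Injective fun i => |ν i| := by
    intro i j hij
    obtain ⟨s, rfl⟩ := (pairEquiv hd2).surjective i
    obtain ⟨s', rfl⟩ := (pairEquiv hd2).surjective j
    simp only [hν, pairCoord_pairEquiv] at hij
    congr 1
    rcases s with i | i <;> rcases s' with j | j
    · exact congrArg _ (hαinj hij)
    · exact absurd hij (hαr i j)
    · exact absurd hij.symm (hαr j i)
    · simp only [Sum.elim_inr, abs_pow] at hij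
      exact congrArg _ (hrinj ((pow_left_inj₀ (abs_nonneg _) (abs_nonneg _) three_ne_zero).1 hij))
  have hν0 : ∀ i, ν i ≠ 0 := by
    intro i
    obtain ⟨s, rfl⟩ := (pairEquiv hd2).surjective i
    rw [hν, pairCoord_pairEquiv]
    rcases s with i | i
    · exact (hα0 i).ne'
    · exact pow_ne_zero 3 (hr0 i)
  have hν1 : ∀ i, |ν i| ≠ 1 := by
    intro i
    obtain ⟨s, rfl⟩ := (pairEquiv hd2).surjective i
    rw [hν, pairCoord_pairEquiv]
    rcases s with i | i
    · exact hα1 i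
    · simp only [Sum.elim_inr, abs_pow]
      exact fun h => hr1 i ((pow_eq_one_iff_of_nonneg (abs_nonneg _) three_ne_zero).1 h)
  have hνv : ∀ i, ∃ x : Fin d → ℝ, x ≠ 0 ∧ intAct M.val x = ν i • x := by
    intro i
    obtain ⟨s, rfl⟩ := (pairEquiv hd2).surjective i
    rw [hν, pairCoord_pairEquiv]
    rcases s with i | i
    · obtain ⟨x, hx0, hx⟩ := hαv i
      exact ⟨pairCoord x 0, pairCoord_ne_zero_left hd2 hx0, pairGL_eigen_left hd2 _ hx⟩
    · exact ⟨pairCoord 0 (v i), pairCoord_ne_zero_right hd2 (hv0 i),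
        pairGL_eigen_right hd2 _ (intAct_pow_three (hv i))⟩
  obtain ⟨E, E', hEl, hEr, hE⟩ := exists_diagonalization (injective_of_abs hνinj) hνv
  have hcoord : ∀ z : Fin d → ℝ, intAct M.val z = pairCoord
      (intAct (traceMatrix t).val fun i => z (pairEquiv hd2 (Sum.inl i)))
      (intAct (B ^ 3).val fun j => z (pairEquiv hd2 (Sum.inr j))) := fun z => by
    conv_lhs => rw [pairCoord_surjective hd2 z]
    rw [hM, intAct_pairGL]
  let S : SkewModel d :=
    { M := M
      t := t
      μ := μ
      σ := r j₀ ^ 3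
      i₀ := pairEquiv hd2 (Sum.inl 0)
      i₁ := pairEquiv hd2 (Sum.inl 1)
      e := pairCoord 0 (v j₀)
      w := pairCoord ![μ, 1] 0
      ν := ν
      E := E
      E' := E'
      one_lt_σ := one_lt_pow₀ hj₀ three_ne_zero
      σ_lt_μ := by
        have := hupper j₀
        rwa [abs_of_pos (one_pos.trans hj₀)] at this
      trace_eq := htμ
      act_i₀ := fun z => by
        rw [hcoord, pairCoord_pairEquiv]
        exact traceMatrix_act_zero _
      act_i₁ := fun z => by
        rw [hcoord, pairCoord_pairEquiv]
        exact traceMatrix_act_one _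
      e_i₀ := by simp [pairCoord_pairEquiv]
      e_i₁ := by simp [pairCoord_pairEquiv]
      e_ne_zero := pairCoord_ne_zero_right hd2 (hv0 j₀)
      act_e := pairGL_eigen_right hd2 _ (intAct_pow_three (hv j₀))
      act_w := pairGL_eigen_left hd2 _ (traceMatrix_eigen htμ)
      w_i₀ := by simp [pairCoord_pairEquiv, hμ0.ne']
      left_inv := hEl
      right_inv := hEr
      act_E := hE
      ν_ne_zero := hν0
      ν_ne_one := hν1
      ν_inj := hνinj }
  -- The exponents `n = 1`, `m = 3` only have to satisfy `n < m`; the domination comes from the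
  -- trace of `A`.
  refine ⟨traceMatrix t, B, 1, 3, r j₀, v j₀, M,
    isHyperbolicMatrix_of_eigen (injective_of_abs hαinj) hα1 hαv,
    ⟨α, injective_of_abs hαinj, hαv⟩,
    isHyperbolicMatrix_of_eigen (injective_of_abs hrinj) hr1 fun i => ⟨v i, hv0 i, hv i⟩,
    ⟨r, injective_of_abs hrinj, fun i => ⟨v i, hv0 i, hv i⟩⟩, le_rfl, by norm_num, hv0 j₀, hv j₀,
    hj₀.trans_le (le_abs_self _), fun x y => ?_,
    isHyperbolicMatrix_of_eigen (injective_of_abs hνinj) hν1 hνv,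
    ⟨ν, injective_of_abs hνinj, hνv⟩, ?_⟩
  · rw [pow_one]
    exact intAct_pairGL hd2 _ _ x y
  · rintro U ⟨k, ε, hε, hU⟩
    obtain ⟨δ, hδ, hclose⟩ := S.exists_crClose k hε
    refine ⟨S.skew δ, hU hclose, ⟨fun x => δ * circleOneSubCos (x 0), ?_, fun x y => ?_⟩,
      S.isAnosov_skew δ, S.isRegularPoint_skew δ, S.isLinearization_skew δ,
      ⟨S.conj δ, S.isConjugacy_conj δ⟩, fun N h hconj => ⟨?_, ?_⟩⟩
    · simp only [Torus.proj, circleOneSubCos_coe]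
      fun_prop
    · have hψ : S.ψ δ (pairCoord x y) = δ * circleOneSubCos (x 0) := by
        simp only [SkewModel.ψ, S, pairCoord_pairEquiv, Sum.elim_inl]
      rw [S.skew_apply, hψ, pow_one]
      change intAct M.val (pairCoord x y) + Torus.proj (_ • pairCoord 0 (v j₀)) = _
      rw [hM, intAct_pairGL, smul_pairCoord, smul_zero, proj_pairCoord, Torus.proj_zero,
        pairCoord_add, add_zero]
    · rintro ⟨K, hK⟩
      exact S.not_lipschitz_conjugacy hδ hconj hK
    · rintro ⟨K, hK⟩
      exact S.not_lipschitz_conjugacy_symm hδ hconj hK
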